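/- Let $\alpha,\beta\in\mathbb R$, let $\sigma$ be a finite positive Borel measure on $\mathbb R$ that is concentrated on $[\alpha,\beta]$ and whose support is infinite (for instance a probability measure with infinite support), and let $$\varphi(\lambda)=\int_\alpha^\beta\frac{d\sigma(t)}{t-\lambda},\qquad \lambda\in\mathbb C\setminus[\alpha,\beta],$$ be its Markov function. Let $(z_k)_{k\ge 0}$ be complex numbers, not necessarily distinct, such that $\operatorname{Im} z_k>\delta$ for all $k$ and some $\delta>0$, and let $b_0,b_1,\dots$ be arbitrary positive numbers. Put $\varphi_0=\varphi$ and define recursively, for $j\ge0$, $$a^{(2)}_j=-\frac{\operatorname{Im}\bigl(1/\varphi_j(z_j)\bigr)}{\operatorname{Im}z_j},\qquad a^{(1)}_j=a^{(2)}_jz_j+\frac1{\varphi_j(z_j)}\in\mathbb R,\qquad \varphi_{j+1}(\lambda)=-\frac{\frac1{\varphi_j(\lambda)}+a^{(2)}_j\lambda-a^{(1)}_j}{b_j^2(\lambda-z_j)(\lambda-\overline z_j)},$$ where the removable singularities at $z_j,\overline z_j$ are removed, so that $\varphi_j(\lambda)=-1/\bigl(a^{(2)}_j\lambda-a^{(1)}_j+b_j^2(\lambda-z_j)(\lambda-\overline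 z_j)\varphi_{j+1}(\lambda)\bigr)$. Let $$R_n(\lambda)=-\cfrac{1}{a^{(2)}_0\lambda-a^{(1)}_0-\cfrac{b_0^2(\lambda-z_0)(\lambda-\overline z_0)}{a^{(2)}_1\lambda-a^{(1)}_1-\cdots-\cfrac{b_{n-1}^2(\lambda-z_{n-1})(\lambda-\overline z_{n-1})}{a^{(2)}_n\lambda-a^{(1)}_n}}}$$ be the convergents of the resulting continued fraction. An $[L/M]$ multipoint Padé approximant of $\varphi$ at points $p_1,p_2,\dots$ of the Riemann sphere is a rational function, a ratio of polynomials of degrees at most $L$ and $M$, that agrees with $\varphi$ at $p_1,\dots,p_{L+M+1}$; a point that occurs $m$ times among these is required to be a zero of the difference of order at least $m$. Then: 1. for every $n\ge0$, $R_n$ is the unique $[n+1/n+1]$ multipoint Padé approximant of $\varphi$ at the points $\infty,z_0,\overline z_0,z_1,\overline z_1,\dots$ (so its interpolation points are $\infty,z_0,\overline z_0,\dots,z_n,\overline z_n$); 2. all poles of each $R_n$ lie in $[\alpha,\beta]$; 3. $R_n\to\varphi$ as $n\to\infty$, locally uniformly on $\mathbb C\setminus[\alpha,\beta]$. -/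

import Mathlib

open MeasureTheory Filter Topology Set

noncomputable section

/-- The Markov function `φ(lam) = ∫ dσ(t) / (t - lam)` of a measure `σ` on the real line. -/
def markovFunction (σ : Measure ℝ) (lam : ℂ) : ℂ :=
  ∫ t, ((t : ℂ) - lam)⁻¹ ∂σ

/-- The interval `[α, β]` as a subset of the complex plane. -/
def complexInterval (α β : ℝ) : Set ℂ :=
  (fun t : ℝ => (t : ℂ)) '' Set.Icc α β

/-- The coefficient `a⁽²⁾ = -Im (1 / φ(z)) / Im z` of one step of the algorithm. -/
def stepA2 (φ : ℂ → ℂ) (z : ℂ) : ℝ :=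
  -((φ z)⁻¹).im / z.im

/-- The coefficient `a⁽¹⁾ = a⁽²⁾ z + 1 / φ(z)` of one step of the algorithm; this number is real
by the choice of `a⁽²⁾`. -/
def stepA1 (φ : ℂ → ℂ) (z : ℂ) : ℝ :=
  ((stepA2 φ z : ℂ) * z + (φ z)⁻¹).re

/-- The function `τ` determined by
`φ(lam) = -1 / (a⁽²⁾ lam - a⁽¹⁾ + b² (lam - z) (lam - conj z) τ(lam))`. The limit over the punctured
neighbourhood supplies the values of `τ` at the removable singularities `z` and `conj z`;
at all other points off the interval it is the value itself. -/
def stepNext (φ : ℂ → ℂ) (z : ℂ) (b : ℝ) (lam : ℂ) : ℂ :=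
  limUnder (𝓝[≠] lam) fun w : ℂ =>
    -((φ w)⁻¹ + (stepA2 φ z : ℂ) * w - (stepA1 φ z : ℂ)) /
      ((b : ℂ) ^ 2 * (w - z) * (w - (starRingEnd ℂ) z))

/-- The functions `φ₀ = φ, φ₁, φ₂, …` of the step-by-step process with nodes `z₀, z₁, …` and
normalizing factors `b₀, b₁, …`. -/
def stepFun (φ : ℂ → ℂ) (z : ℕ → ℂ) (b : ℕ → ℝ) : ℕ → ℂ → ℂ
  | 0 => φ
  | j + 1 => stepNext (stepFun φ z b j) (z j) (b j)

/-- The linear polynomial `a⁽²⁾_j lam - a⁽¹⁾_j`, as a rational function of `lam`. -/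
def linearTerm (φ : ℂ → ℂ) (z : ℕ → ℂ) (b : ℕ → ℝ) (j : ℕ) : RatFunc ℂ :=
  RatFunc.C (stepA2 (stepFun φ z b j) (z j) : ℂ) * RatFunc.X -
    RatFunc.C (stepA1 (stepFun φ z b j) (z j) : ℂ)

/-- The finite continued fraction with `n + 1` terms which starts at the index `j`:
`-1 / (a⁽²⁾_j lam - a⁽¹⁾_j + b_j² (lam - z_j) (lam - conj z_j) K)`, where `K` is the one with
`n` terms which starts at the index `j + 1` (and is absent when `n = 0`). -/
def tailFraction (φ : ℂ → ℂ) (z : ℕ → ℂ) (b : ℕ → ℝ) : ℕ → ℕ → RatFunc ℂ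
  | 0, j => -1 / linearTerm φ z b j
  | n + 1, j =>
      -1 / (linearTerm φ z b j +
        RatFunc.C ((b j : ℂ) ^ 2) * (RatFunc.X - RatFunc.C (z j)) *
          (RatFunc.X - RatFunc.C ((starRingEnd ℂ) (z j))) * tailFraction φ z b n (j + 1))

/-- The convergent `R_n`, truncated after the term `a⁽²⁾_n lam - a⁽¹⁾_n`. -/
def convergent (φ : ℂ → ℂ) (z : ℕ → ℂ) (b : ℕ → ℝ) (n : ℕ) : RatFunc ℂ :=
  tailFraction φ z b n 0

/-- The order to which `f - g` vanishes at a point of the Riemann sphere. It is at least one iff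
`f - g` is analytic at the point and vanishes there; at `∞` this is read in the coordinate
`1 / lam`. -/
def contactOrder (f g : ℂ → ℂ) : OnePoint ℂ → ℕ∞
  | none => analyticOrderAt (fun w : ℂ => if w = 0 then 0 else f w⁻¹ - g w⁻¹) 0
  | some p => analyticOrderAt (fun w : ℂ => f w - g w) p

/-- `f` is an `[L/M]` multipoint Padé approximant of `φ` at the points `p 0, p 1, …`: a ratio of
polynomials of degrees at most `L` and `M` which agrees with `φ` at the first `L + M + 1` points,
a repeated point being counted with its multiplicity. -/
def IsMultipointPade (φ : ℂ → ℂ) (p : ℕ → OnePoint ℂ) (L M : ℕ) (f : RatFunc ℂ) : Prop :=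
  f.num.natDegree ≤ L ∧ f.denom.natDegree ≤ M ∧
    ∀ k < L + M + 1,
      (({i : ℕ | i < L + M + 1 ∧ p i = p k}.ncard : ℕ) : ℕ∞) ≤
        contactOrder (fun w => f.eval (RingHom.id ℂ) w) φ (p k)

/-- The interpolation points `∞, z₀, conj z₀, z₁, conj z₁, …`. -/
def padeNodes (z : ℕ → ℂ) : ℕ → OnePoint ℂ
  | 0 => OnePoint.infty
  | k + 1 =>
      if k % 2 = 0 then ((z (k / 2) : ℂ) : OnePoint ℂ)
      else (((starRingEnd ℂ) (z (k / 2)) : ℂ) : OnePoint ℂ)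

end

noncomputable section

/-! Write ω_n for the product of (t - z_k)(t - conj z_k) over k < n; it is positive on the real
line. Let Q_n be the monic orthogonal polynomial of degree n for the measure dσ/ω_n. Its zeros lie
in [α, β], are simple, and carry a Gauss rule exact below degree 2n (`exists_gauss_rule`). Let
P_n/Q_n be the Cauchy transform of the quadrature measure with masses v(x) ω_n(x). Exactness on a
divided difference gives Q_n φ - P_n = ω_n E_n, where E_n is the function of the second kind
(`rootPoly_mul_markovFunction`). A second use of exactness shows that E_n has no zero off [α, β]
(`secondKind_ne_zero`). Hence P_n/Q_n interpolates φ at ∞ and at the zeros of ω_n. It is the only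
such function, since the cross product of two solutions has degree below 2n and is divisible by ω_n.

The algorithm produces the same fractions. Inductively φ_j = c_j E_j / E_{j-1} with a nonzero real
c_j and E_{-1} = 1. The coefficients of a step make -E_{j-1} - c_j (a⁽²⁾_j λ - a⁽¹⁾_j) E_j vanish at
z_j and conj z_j. By uniqueness this combination is a multiple of (λ - z_j)(λ - conj z_j) E_{j+1},
which is a three-term recurrence for Q and P (`exists_step`). Solving it backwards gives R_n =
P_{n+1}/Q_{n+1} (`tailFraction_eq`, `convergent_eq`), so the poles lie in [α, β].

For convergence, the quadrature measures have bounded mass, and their Cauchy transforms differ from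
φ by at most a constant times the distance on [α, β] from 1/(t - λ) to the functions p/ω_n with deg
p < 2n. A Blaschke-type product for a disc that contains [α, β] and excludes λ and all z_k makes
this distance O(q^n) with q < 1 (`exists_separating_disc`, `exists_blaschke_ratio`). Equicontinuity
turns pointwise into locally uniform convergence. -/

open Polynomial

/-! ### Gauss quadrature for positive functionals. -/

/-- The polynomial whose values on the real line are the complex conjugates of those of `p`. -/
def conjPoly (p : Polynomial ℂ) : Polynomial ℂ := p.map (starRingEnd ℂ)

theorem conjPoly_eval (p : Polynomial ℂ) (x : ℂ) :
    (conjPoly p).eval ((starRingEnd ℂ) x) = (starRingEnd ℂ) (p.eval x) := by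
  rw [conjPoly, Polynomial.eval_map, Polynomial.eval₂_hom]

theorem conjPoly_eval_ofReal (p : Polynomial ℂ) (t : ℝ) :
    (conjPoly p).eval (t : ℂ) = (starRingEnd ℂ) (p.eval (t : ℂ)) := by
  rw [← conjPoly_eval, Complex.conj_ofReal]

theorem conjPoly_degree (p : Polynomial ℂ) : (conjPoly p).degree = p.degree :=
  Polynomial.degree_map _ _

theorem conjPoly_mul (p q : Polynomial ℂ) : conjPoly (p * q) = conjPoly p * conjPoly q :=
  Polynomial.map_mul _

/-- Orthogonality to the powers below n imposes n linear conditions on n + 1 coefficients. -/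
theorem exists_orthogonal_polynomial (L : ℂ[X] →ₗ[ℂ] ℂ) (n : ℕ) :
    ∃ Q : ℂ[X], Q ≠ 0 ∧ Q.degree ≤ n ∧ ∀ p : ℂ[X], p.degree < n → L (Q * p) = 0 := by
  let F : degreeLT ℂ (n + 1) →ₗ[ℂ] (Fin n → ℂ) :=
    LinearMap.pi fun k => (L.comp (LinearMap.mulRight ℂ (X ^ (k : ℕ)))).comp
      (degreeLT ℂ (n + 1)).subtype
  have hker : LinearMap.ker F ≠ ⊥ := by
    apply LinearMap.ker_ne_bot_of_finrank_lt
    rw [(degreeLTEquiv ℂ (n + 1)).finrank_eq]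
    simp
  obtain ⟨⟨Q, hQ⟩, hQF, hQ0⟩ := Submodule.exists_mem_ne_zero_of_ne_bot hker
  refine ⟨Q, fun h => hQ0 (by simpa using h), ?_, ?_⟩
  · rw [mem_degreeLT] at hQ
    by_cases h0 : Q = 0
    · simp [h0]
    rw [degree_eq_natDegree h0] at hQ ⊢
    norm_cast at hQ ⊢
    omega
  · intro p hp
    have hX : ∀ k : ℕ, k < n → L (Q * X ^ k) = 0 := by
      intro k hk
      have := congrFun (LinearMap.mem_ker.mp hQF) ⟨k, hk⟩
      simpa [F] using this
    rw [p.as_sum_range_C_mul_X_pow, Finset.mul_sum, map_sum]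
    apply Finset.sum_eq_zero
    intro k hk
    by_cases hpk : p.coeff k = 0
    · simp [hpk]
    have hkn : k < n := by
      have := (le_degree_of_ne_zero hpk).trans_lt hp
      exact_mod_cast this
    rw [mul_left_comm, ← smul_eq_C_mul, map_smul, hX k hkn, smul_zero]

/-- Gauss quadrature for a positive functional on polynomials. -/
theorem exists_gauss_rule (L : ℂ[X] →ₗ[ℂ] ℂ) (S : Set ℝ)
    (hpos : ∀ p : ℂ[X], p ≠ 0 → ∃ r : ℝ, 0 < r ∧ L (p * conjPoly p) = r)
    (hloc : ∀ p : ℂ[X], p ≠ 0 → ∀ lam : ℂ, L ((X - C lam) * (p * conjPoly p)) = 0 →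
      ∃ x ∈ S, (x : ℂ) = lam) (n : ℕ) :
    ∃ (N : Finset ℝ) (v : ℝ → ℝ), (∀ x ∈ N, x ∈ S) ∧ N.card = n ∧ (∀ x ∈ N, 0 < v x) ∧
      ∀ p : ℂ[X], p.degree < (2 * n : ℕ) → L p = ∑ x ∈ N, (v x : ℂ) * p.eval (x : ℂ) := by
  classical
  obtain ⟨Q, hQ0, hQn, hQ⟩ := exists_orthogonal_polynomial L n
  have hdeg : Q.degree = n := by
    -- If the degree were smaller, Q would be orthogonal to its own conjugate, against positivity.
    refine le_antisymm hQn (not_lt.mp fun hlt => ?_)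
    obtain ⟨r, hr, h⟩ := hpos Q hQ0
    rw [hQ _ (by rwa [conjPoly_degree])] at h
    exact hr.ne (by exact_mod_cast h)
  have hnat : Q.natDegree = n := natDegree_eq_of_degree_eq_some hdeg
  -- a root splits off a factor of smaller degree
  have hfac : ∀ lam, Q.IsRoot lam → ∃ q : ℂ[X], Q = (X - C lam) * q ∧ q ≠ 0 ∧ q.degree < n := by
    intro lam h
    obtain ⟨q, hq⟩ := dvd_iff_isRoot.mpr h
    have hq0 : q ≠ 0 := by rintro rfl; simp [hQ0] at hq
    refine ⟨q, hq, hq0, ?_⟩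
    have : Q.natDegree = 1 + q.natDegree := by
      rw [hq, natDegree_mul (X_sub_C_ne_zero _) hq0, natDegree_X_sub_C]
    rw [degree_eq_natDegree hq0]
    exact_mod_cast (by omega : q.natDegree < n)
  -- For Q = (X - lam) q, testing Q against the conjugate of q gives the hypothesis of `hloc`.
  have hreal : ∀ lam, Q.IsRoot lam → ∃ x ∈ S, (x : ℂ) = lam := by
    intro lam h
    obtain ⟨q, hq, hq0, hqn⟩ := hfac lam h
    apply hloc q hq0
    rw [← mul_assoc, ← hq]
    exact hQ _ (by rwa [conjPoly_degree])
  -- If Q = (X - lam)² s with lam real, testing Q against the conjugate of s yields the positive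
  -- square of (X - lam) s.
  have hsimple : Q.roots.Nodup := by
    rw [Multiset.nodup_iff_count_le_one]
    intro lam
    rw [count_roots]
    by_contra! h2
    have hd : (X - C lam) ^ 2 ∣ Q := (le_rootMultiplicity_iff hQ0).mp h2
    obtain ⟨s, hs⟩ := hd
    have hroot : Q.IsRoot lam := by rw [hs]; simp [IsRoot]
    obtain ⟨x, hx, hxl⟩ := hreal lam hroot
    have hs0 : s ≠ 0 := by rintro rfl; simp [hQ0] at hs
    obtain ⟨r, hr, h⟩ := hpos _ (mul_ne_zero (X_sub_C_ne_zero lam) hs0)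
    have hsd : (conjPoly s).degree < n := by
      have : Q.natDegree = 2 + s.natDegree := by
        rw [hs, natDegree_mul (pow_ne_zero _ (X_sub_C_ne_zero _)) hs0, natDegree_pow,
          natDegree_X_sub_C]
      rw [conjPoly_degree, degree_eq_natDegree hs0]
      exact_mod_cast (by omega : s.natDegree < n)
    have hconj : conjPoly (X - C lam) = X - C lam := by
      rw [← hxl]; simp [conjPoly]
    have : (X - C lam) * s * conjPoly ((X - C lam) * s) = Q * conjPoly s := by
      rw [conjPoly_mul, hconj, hs]; ring
    rw [this, hQ _ hsd] at h
    exact hr.ne (by exact_mod_cast h)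
  have hcard : Q.roots.toFinset.card = n := by
    rw [Multiset.toFinset_card_of_nodup hsimple, ← hnat]
    exact (IsAlgClosed.splits Q).natDegree_eq_card_roots.symm
  have hmem : ∀ lam, lam ∈ Q.roots.toFinset ↔ Q.IsRoot lam := by
    intro lam; simp [hQ0]
  let N : Finset ℝ := Q.roots.toFinset.image Complex.re
  have hN : N.map ⟨Complex.ofReal, Complex.ofReal_injective⟩ = Q.roots.toFinset := by
    ext lam
    simp only [N, Finset.mem_map, Finset.mem_image, Function.Embedding.coeFn_mk]
    constructor
    · rintro ⟨x, ⟨y, hy, rfl⟩, rfl⟩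
      obtain ⟨x, -, rfl⟩ := hreal y ((hmem y).mp hy)
      simpa using hy
    · intro h
      obtain ⟨x, -, rfl⟩ := hreal lam ((hmem lam).mp h)
      exact ⟨x, ⟨_, h, by simp⟩, rfl⟩
  have hNcard : N.card = n := by rw [← hcard, ← hN, Finset.card_map]
  have hNroot : ∀ x ∈ N, Q.eval (x : ℂ) = 0 := by
    intro x hx
    have : (x : ℂ) ∈ Q.roots.toFinset := by rw [← hN]; simpa using hx
    exact (hmem _).mp this
  have hNS : ∀ x ∈ N, x ∈ S := by
    intro x hx
    obtain ⟨y, hy, hyx⟩ := hreal _ (hNroot x hx)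
    rwa [← Complex.ofReal_injective hyx]
  have hinj : Set.InjOn (fun x : ℝ => (x : ℂ)) N := Complex.ofReal_injective.injOn
  let l : ℝ → ℂ[X] := Lagrange.basis N (fun x : ℝ => (x : ℂ))
  -- Divide by Q: the quotient has degree below n and is killed by orthogonality; the remainder is
  -- its own Lagrange interpolant and agrees with p at the nodes.
  have hexact : ∀ p : ℂ[X], p.degree < (2 * n : ℕ) →
      L p = ∑ x ∈ N, L (l x) * p.eval (x : ℂ) := by
    intro p hp
    have h1 : p = Q * (p / Q) + p % Q := (EuclideanDomain.div_add_mod p Q).symm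
    have h2 : L (Q * (p / Q)) = 0 := by
      apply hQ
      by_cases hpq : p.degree < Q.degree
      · rw [(Polynomial.div_eq_zero_iff hQ0).mpr hpq, degree_zero]; exact WithBot.bot_lt_coe _
      · have h3 := degree_add_div hQ0 (not_lt.mp hpq)
        have h0 : p / Q ≠ 0 := fun h => hpq ((Polynomial.div_eq_zero_iff hQ0).mp h)
        rw [← h3, hdeg, degree_eq_natDegree h0] at hp
        rw [degree_eq_natDegree h0]
        norm_cast at hp ⊢
        omega
    have h3 : p % Q = Lagrange.interpolate N (fun x : ℝ => (x : ℂ)) (fun x => p.eval (x : ℂ)) := by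
      apply Lagrange.eq_interpolate_of_eval_eq _ hinj
      · rw [hNcard, ← hdeg]; exact degree_mod_lt p hQ0
      · intro x hx
        conv_rhs => rw [h1]
        simp [hNroot x hx]
    conv_lhs => rw [h1]
    rw [map_add, h2, zero_add, h3, Lagrange.interpolate_apply, map_sum]
    apply Finset.sum_congr rfl
    intro x hx
    rw [← smul_eq_C_mul, map_smul, smul_eq_mul, mul_comm]
  -- The rule is exact on the square of the basis polynomial, of degree 2n - 2, and only the node x
  -- contributes to it; so the weight equals a positive square.
  have hv : ∀ x ∈ N, ∃ r : ℝ, 0 < r ∧ L (l x) = r := by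
    intro x hx
    obtain ⟨r, hr, h⟩ := hpos (l x) (Lagrange.basis_ne_zero hinj hx)
    refine ⟨r, hr, ?_⟩
    have hld : (l x).degree < n := by
      rw [Lagrange.degree_basis hinj hx, hNcard]
      have : 0 < N.card := Finset.card_pos.mpr ⟨x, hx⟩
      exact_mod_cast (by omega : n - 1 < n)
    rw [← h, hexact (l x * conjPoly (l x)), Finset.sum_eq_single x]
    · rw [eval_mul, conjPoly_eval_ofReal]
      have : (l x).eval (x : ℂ) = 1 := Lagrange.eval_basis_self hinj hx
      simp [this]
    · intro y hy hyx
      have : (l x).eval (y : ℂ) = 0 := Lagrange.eval_basis_of_ne hyx.symm hy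
      simp [this]
    · exact fun h => absurd hx h
    · have h0 : l x ≠ 0 := Lagrange.basis_ne_zero hinj hx
      rw [degree_mul, conjPoly_degree, degree_eq_natDegree h0]
      rw [degree_eq_natDegree h0] at hld
      norm_cast at hld ⊢
      omega
  refine ⟨N, fun x => (L (l x)).re, hNS, hNcard, ?_, ?_⟩
  · intro x hx
    obtain ⟨r, hr, h⟩ := hv x hx
    simpa [h] using hr
  · intro p hp
    rw [hexact p hp]
    apply Finset.sum_congr rfl
    intro x hx
    obtain ⟨r, hr, h⟩ := hv x hx
    simp [h]

/-! ### Integrals against a measure on [α, β]: positivity, non-vanishing, holomorphy. -/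

section
theorem ae_mem_Icc {α β : ℝ} {σ : Measure ℝ} (hσ : σ (Set.Icc α β)ᶜ = 0) : ∀ᵐ t ∂σ, t ∈ Set.Icc α β := hσ

variable {α β : ℝ} {σ : Measure ℝ} [IsFiniteMeasure σ]

theorem integrable_of_continuousOn_Icc {E : Type*} [NormedAddCommGroup E]
    (hσ : σ (Set.Icc α β)ᶜ = 0) {f : ℝ → E} (hf : ContinuousOn f (Set.Icc α β)) :
    Integrable f σ := by
  have h := hf.integrableOn_compact (μ := σ) isCompact_Icc
  rwa [IntegrableOn, Measure.restrict_eq_self_of_ae_mem (ae_mem_Icc hσ)] at h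

theorem ofReal_sub_ne_zero {lam : ℂ} (h : lam ∈ (complexInterval α β)ᶜ) {t : ℝ}
    (ht : t ∈ Set.Icc α β) : (t : ℂ) - lam ≠ 0 :=
  fun h0 => h ⟨t, ht, sub_eq_zero.mp h0⟩

theorem isOpen_compl_complexInterval : IsOpen (complexInterval α β)ᶜ :=
  (isCompact_Icc.image Complex.continuous_ofReal).isClosed.isOpen_compl

theorem conj_mem_compl_complexInterval {lam : ℂ} (h : lam ∈ (complexInterval α β)ᶜ) :
    (starRingEnd ℂ) lam ∈ (complexInterval α β)ᶜ := by
  rintro ⟨t, ht, h1⟩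
  refine h ⟨t, ht, ?_⟩
  have := congrArg (starRingEnd ℂ) h1
  simpa using this

theorem mem_compl_complexInterval_of_im {lam : ℂ} (h : lam.im ≠ 0) :
    lam ∈ (complexInterval α β)ᶜ := by
  rintro ⟨t, -, rfl⟩
  simp at h

theorem continuousOn_inv_ofReal_sub {lam : ℂ} (h : lam ∈ (complexInterval α β)ᶜ) :
    ContinuousOn (fun t : ℝ => ((t : ℂ) - lam)⁻¹) (Set.Icc α β) :=
  ContinuousOn.inv₀ (by fun_prop) fun _ ht => ofReal_sub_ne_zero h ht

theorem exists_dist_le {lam : ℂ} (h : lam ∈ (complexInterval α β)ᶜ) :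
    ∃ d > 0, ∀ t ∈ Set.Icc α β, d ≤ ‖(t : ℂ) - lam‖ := by
  obtain ⟨d, hd, hball⟩ := Metric.isOpen_iff.mp isOpen_compl_complexInterval lam h
  refine ⟨d, hd, fun t ht => not_lt.mp fun hlt => ?_⟩
  exact hball (by rwa [Metric.mem_ball, dist_eq_norm]) ⟨t, ht, rfl⟩

/-- Were the integral zero, σ would be carried by the finite closed zero set of p, and its support
would be finite. -/
theorem integral_weight_pos (hσ : σ (Set.Icc α β)ᶜ = 0) (hsupp : σ.support.Infinite)
    {w : ℝ → ℝ} (hw : ContinuousOn w (Set.Icc α β)) (hw0 : ∀ t ∈ Set.Icc α β, 0 < w t)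
    {p : Polynomial ℂ} (hp : p ≠ 0) : 0 < ∫ t, w t * ‖p.eval (t : ℂ)‖ ^ 2 ∂σ := by
  have hint : Integrable (fun t : ℝ => w t * ‖p.eval (t : ℂ)‖ ^ 2) σ :=
    integrable_of_continuousOn_Icc hσ (hw.mul (by fun_prop))
  rw [integral_pos_iff_support_of_nonneg_ae _ hint]
  · rw [pos_iff_ne_zero]
    intro h0
    have hfin : {t : ℝ | p.eval (t : ℂ) = 0}.Finite := by
      have := (p.roots.toFinset.finite_toSet).preimage (Complex.ofReal_injective.injOn)
      refine this.subset fun t ht => ?_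
      simpa [hp] using ht
    refine hsupp (hfin.subset (Measure.support_subset_of_isClosed hfin.isClosed ?_))
    have h1 : ∀ᵐ t ∂σ, t ∉ Function.support (fun t : ℝ => w t * ‖p.eval (t : ℂ)‖ ^ 2) :=
      measure_eq_zero_iff_ae_notMem.mp h0
    filter_upwards [h1, ae_mem_Icc hσ] with t ht hti
    simpa [(hw0 t hti).ne'] using ht
  · filter_upwards [ae_mem_Icc hσ] with t ht
    have := (hw0 t ht).le
    positivity

/-- A zero would make lam the barycentre of u dσ, which lies in [α, β]. -/
theorem integral_mul_sub_ne_zero (hσ : σ (Set.Icc α β)ᶜ = 0) {u : ℝ → ℝ}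
    (hu : ContinuousOn u (Set.Icc α β)) (hu0 : ∀ t ∈ Set.Icc α β, 0 ≤ u t)
    (hpos : 0 < ∫ t, u t ∂σ) {lam : ℂ} (hlam : lam ∈ (complexInterval α β)ᶜ) :
    ∫ t, (u t : ℂ) * ((t : ℂ) - lam) ∂σ ≠ 0 := by
  have hui := integrable_of_continuousOn_Icc hσ hu
  have huti : Integrable (fun t => u t * t) σ :=
    integrable_of_continuousOn_Icc hσ (hu.mul continuousOn_id)
  have key : ∫ t, (u t : ℂ) * ((t : ℂ) - lam) ∂σ =
      ((∫ t, u t * t ∂σ : ℝ) : ℂ) - lam * ((∫ t, u t ∂σ : ℝ) : ℂ) := by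
    rw [← integral_complex_ofReal, ← integral_complex_ofReal, ← integral_const_mul,
      ← integral_sub]
    · congr 1 with t
      push_cast
      ring
    · exact huti.ofReal
    · exact hui.ofReal.const_mul _
  intro h0
  rw [key] at h0
  set m := ∫ t, u t ∂σ with hm
  have him : lam.im = 0 := by
    have := congrArg Complex.im h0
    simpa [hpos.ne'] using this
  have hre : ∫ t, u t * t ∂σ = lam.re * m := by
    have := congrArg Complex.re h0
    simp [him] at this
    linarith
  have hlo : α * m ≤ lam.re * m := by
    rw [← hre, hm, ← integral_const_mul]
    refine integral_mono_ae (hui.const_mul _) huti ?_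
    filter_upwards [ae_mem_Icc hσ] with t ht
    have := mul_le_mul_of_nonneg_left ht.1 (hu0 t ht)
    simpa [mul_comm] using this
  have hhi : lam.re * m ≤ β * m := by
    rw [← hre, hm, ← integral_const_mul]
    refine integral_mono_ae huti (hui.const_mul _) ?_
    filter_upwards [ae_mem_Icc hσ] with t ht
    have := mul_le_mul_of_nonneg_left ht.2 (hu0 t ht)
    simpa [mul_comm] using this
  refine hlam ⟨lam.re, ⟨le_of_mul_le_mul_right hlo hpos, le_of_mul_le_mul_right hhi hpos⟩, ?_⟩
  exact Complex.ext (by simp) (by simp [him])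

/-- Since 1/(t - lam) = (t - conj lam)/|t - lam|², this is the barycentre argument for a modified
weight and the point conj lam. -/
theorem integral_mul_inv_sub_ne_zero (hσ : σ (Set.Icc α β)ᶜ = 0) (hsupp : σ.support.Infinite)
    {w : ℝ → ℝ} (hw : ContinuousOn w (Set.Icc α β)) (hw0 : ∀ t ∈ Set.Icc α β, 0 < w t)
    {p : Polynomial ℂ} (hp : p ≠ 0) {lam : ℂ} (hlam : lam ∈ (complexInterval α β)ᶜ) :
    ∫ t, ((w t * ‖p.eval (t : ℂ)‖ ^ 2 : ℝ) : ℂ) * ((t : ℂ) - lam)⁻¹ ∂σ ≠ 0 := by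
  have hpos : ∀ t ∈ Set.Icc α β, 0 < ‖(t : ℂ) - lam‖ :=
    fun t ht => norm_pos_iff.mpr (ofReal_sub_ne_zero hlam ht)
  have hw' : ContinuousOn (fun t : ℝ => w t * (‖(t : ℂ) - lam‖ ^ 2)⁻¹) (Set.Icc α β) :=
    hw.mul (ContinuousOn.inv₀ (by fun_prop) fun t ht => (pow_pos (hpos t ht) 2).ne')
  have hw0' : ∀ t ∈ Set.Icc α β, 0 < w t * (‖(t : ℂ) - lam‖ ^ 2)⁻¹ := fun t ht =>
    mul_pos (hw0 t ht) (inv_pos.mpr (pow_pos (hpos t ht) 2))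
  have hI := integral_weight_pos hσ hsupp hw' hw0' hp
  have := integral_mul_sub_ne_zero hσ
    (u := fun t : ℝ => w t * (‖(t : ℂ) - lam‖ ^ 2)⁻¹ * ‖p.eval (t : ℂ)‖ ^ 2) (hw'.mul (by fun_prop))
    (fun t ht => mul_nonneg (hw0' t ht).le (sq_nonneg _)) hI (conj_mem_compl_complexInterval hlam)
  convert this using 1
  refine integral_congr_ae ?_
  filter_upwards [ae_mem_Icc hσ] with t ht
  have h1 : ((t : ℂ) - lam) ≠ 0 := ofReal_sub_ne_zero hlam ht
  have h2 : ((t : ℂ) - (starRingEnd ℂ) lam) = (starRingEnd ℂ) ((t : ℂ) - lam) := by simp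
  have h3 : (((‖(t : ℂ) - lam‖ ^ 2 : ℝ)) : ℂ) =
      ((t : ℂ) - lam) * (starRingEnd ℂ) ((t : ℂ) - lam) := by
    rw [Complex.mul_conj, Complex.normSq_eq_norm_sq]
  have h4 : (starRingEnd ℂ) ((t : ℂ) - lam) ≠ 0 := (_root_.map_ne_zero _).mpr h1
  simp only [Complex.ofReal_mul, Complex.ofReal_inv, h3, h2]
  field_simp

/-- Integration against `w dσ`, as a functional on polynomials. -/
def weightFunctional (hσ : σ (Set.Icc α β)ᶜ = 0) {w : ℝ → ℝ}
    (hw : ContinuousOn w (Set.Icc α β)) : Polynomial ℂ →ₗ[ℂ] ℂ where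
  toFun p := ∫ t, (w t : ℂ) * p.eval (t : ℂ) ∂σ
  map_add' p q := by
    have h : ∀ p : Polynomial ℂ, Integrable (fun t : ℝ => (w t : ℂ) * p.eval (t : ℂ)) σ :=
      fun p => integrable_of_continuousOn_Icc hσ
        ((Complex.continuous_ofReal.comp_continuousOn hw).mul (by fun_prop))
    rw [← integral_add (h p) (h q)]
    simp [mul_add]
  map_smul' c p := by
    simp only [Polynomial.eval_smul, smul_eq_mul, RingHom.id_apply]
    rw [← integral_const_mul]
    congr 1 with t
    ring

theorem exists_gauss_rule_of_weight (hσ : σ (Set.Icc α β)ᶜ = 0) (hsupp : σ.support.Infinite)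
    {w : ℝ → ℝ} (hw : ContinuousOn w (Set.Icc α β)) (hw0 : ∀ t ∈ Set.Icc α β, 0 < w t) (n : ℕ) :
    ∃ (N : Finset ℝ) (v : ℝ → ℝ), (∀ x ∈ N, x ∈ Set.Icc α β) ∧ N.card = n ∧ (∀ x ∈ N, 0 < v x) ∧
      ∀ p : ℂ[X], p.degree < (2 * n : ℕ) →
        ∫ t, (w t : ℂ) * p.eval (t : ℂ) ∂σ = ∑ x ∈ N, (v x : ℂ) * p.eval (x : ℂ) := by
  have hnorm : ∀ (p : ℂ[X]) (t : ℝ),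
      p.eval (t : ℂ) * (conjPoly p).eval (t : ℂ) = ((‖p.eval (t : ℂ)‖ ^ 2 : ℝ) : ℂ) := by
    intro p t
    rw [conjPoly_eval_ofReal, Complex.mul_conj, Complex.normSq_eq_norm_sq]
  refine exists_gauss_rule (weightFunctional hσ hw) (Set.Icc α β) ?_ ?_ n
  · intro p hp
    refine ⟨_, integral_weight_pos hσ hsupp hw hw0 hp, ?_⟩
    rw [← integral_complex_ofReal]
    refine integral_congr_ae (Eventually.of_forall fun t => ?_)
    simp only [eval_mul, hnorm]
    push_cast
    ring
  · intro p hp lam h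
    by_contra hlam
    have hlam' : lam ∈ (complexInterval α β)ᶜ := fun ⟨x, hx, hxl⟩ => hlam ⟨x, hx, hxl⟩
    refine integral_mul_sub_ne_zero hσ (u := fun t : ℝ => w t * ‖p.eval (t : ℂ)‖ ^ 2)
      (hw.mul (by fun_prop))
      (fun t ht => mul_nonneg (hw0 t ht).le (sq_nonneg _))
      (integral_weight_pos hσ hsupp hw hw0 hp) hlam' ?_
    rw [← h]
    refine integral_congr_ae (Eventually.of_forall fun t => ?_)
    simp only [eval_mul, hnorm, eval_sub, eval_X, eval_C]
    push_cast
    ring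

theorem differentiableOn_integral_mul_inv_sub (hσ : σ (Set.Icc α β)ᶜ = 0) {h : ℝ → ℂ}
    (hh : ContinuousOn h (Set.Icc α β)) :
    DifferentiableOn ℂ (fun lam : ℂ => ∫ t, h t * ((t : ℂ) - lam)⁻¹ ∂σ)
      (complexInterval α β)ᶜ := by
  intro lam hlam
  obtain ⟨d, hd, hdist⟩ := exists_dist_le hlam
  have hball : ∀ x ∈ Metric.ball lam (d / 2), ∀ t ∈ Set.Icc α β, d / 2 ≤ ‖(t : ℂ) - x‖ := by
    intro x hx t ht
    have h1 := hdist t ht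
    have h2 : ‖(t : ℂ) - lam‖ ≤ ‖(t : ℂ) - x‖ + ‖x - lam‖ := by
      have := norm_add_le ((t : ℂ) - x) (x - lam)
      simpa using this
    rw [Metric.mem_ball, dist_eq_norm] at hx
    linarith
  have hmem : ∀ x ∈ Metric.ball lam (d / 2), x ∈ (complexInterval α β)ᶜ := by
    rintro x hx ⟨t, ht, rfl⟩
    have := hball _ hx t ht
    simp at this
    linarith
  have hint : ∀ x ∈ (complexInterval α β)ᶜ, Integrable (fun t : ℝ => h t * ((t : ℂ) - x)⁻¹) σ :=
    fun x hx => integrable_of_continuousOn_Icc hσ (hh.mul (continuousOn_inv_ofReal_sub hx))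
  have := hasDerivAt_integral_of_dominated_loc_of_deriv_le (μ := σ)
    (F := fun (x : ℂ) (t : ℝ) => h t * ((t : ℂ) - x)⁻¹)
    (F' := fun (x : ℂ) (t : ℝ) => h t * (((t : ℂ) - x)⁻¹) ^ 2)
    (bound := fun t => ‖h t‖ * ((d / 2)⁻¹) ^ 2)
    (Metric.ball_mem_nhds lam (half_pos hd)) ?_ (hint lam hlam) ?_ ?_ ?_ ?_
  · exact this.2.differentiableAt.differentiableWithinAt
  · filter_upwards [Metric.ball_mem_nhds lam (half_pos hd)] with x hx
    exact (hint x (hmem x hx)).aestronglyMeasurable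
  · exact (integrable_of_continuousOn_Icc hσ
      (hh.mul ((continuousOn_inv_ofReal_sub hlam).pow 2))).aestronglyMeasurable
  · filter_upwards [ae_mem_Icc hσ] with t ht x hx
    rw [norm_mul, norm_pow, norm_inv]
    have h1 := hball x hx t ht
    gcongr
  · exact integrable_of_continuousOn_Icc hσ (hh.norm.mul continuousOn_const)
  · filter_upwards [ae_mem_Icc hσ] with t ht x hx
    have h1 := ofReal_sub_ne_zero (hmem x hx) ht
    have h2 : HasDerivAt (fun y : ℂ => (t : ℂ) - y) (-1) x := by
      simpa using (hasDerivAt_id x).const_sub (t : ℂ)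
    have h3 := (h2.inv h1).const_mul (h t)
    have e : -(-1) / ((t : ℂ) - x) ^ 2 = ((t : ℂ) - x)⁻¹ ^ 2 := by
      rw [neg_neg, one_div, inv_pow]
    rw [e] at h3
    exact h3

end

/-! ### Real polynomials at complex points and the node polynomials. -/

theorem aeval_ofReal_eq (p : ℝ[X]) (t : ℝ) : aeval (t : ℂ) p = ((p.eval t : ℝ) : ℂ) := by
  have := aeval_algebraMap_apply ℂ t p
  simpa using this

theorem eval_map_ofReal (p : ℝ[X]) (lam : ℂ) :
    (p.map (algebraMap ℝ ℂ)).eval lam = aeval lam p := eval_map_algebraMap p lam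

theorem aeval_conj (p : ℝ[X]) (lam : ℂ) :
    aeval ((starRingEnd ℂ) lam) p = (starRingEnd ℂ) (aeval lam p) :=
  aeval_algHom_apply Complex.conjAe.toAlgHom lam p

theorem continuous_aeval_complex (p : ℝ[X]) : Continuous fun lam : ℂ => aeval lam p := by
  simp only [← eval_map_ofReal]
  exact Polynomial.continuous _

theorem differentiable_aeval_complex (p : ℝ[X]) : Differentiable ℂ fun lam : ℂ => aeval lam p := by
  simp only [← eval_map_ofReal]
  exact Polynomial.differentiable _

/-- The real quadratic polynomial with the roots `z` and `conj z`. -/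
def nodeQuad (z : ℂ) : ℝ[X] := X ^ 2 - C (2 * z.re) * X + C (Complex.normSq z)

/-- The real polynomial whose roots are the first `n` nodes and their conjugates. -/
def nodePoly (z : ℕ → ℂ) (n : ℕ) : ℝ[X] := ∏ k ∈ Finset.range n, nodeQuad (z k)

theorem aeval_nodeQuad (z lam : ℂ) :
    aeval lam (nodeQuad z) = (lam - z) * (lam - (starRingEnd ℂ) z) := by
  have h1 : ((2 * z.re : ℝ) : ℂ) = z + (starRingEnd ℂ) z := by
    rw [Complex.add_conj]
  have h2 : ((Complex.normSq z : ℝ) : ℂ) = z * (starRingEnd ℂ) z := (Complex.mul_conj z).symm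
  simp only [nodeQuad, map_add, map_sub, map_mul, map_pow, aeval_X, aeval_C]
  rw [← map_mul, Complex.coe_algebraMap, h1, h2]
  ring

theorem eval_nodeQuad_pos {z : ℂ} (hz : z.im ≠ 0) (t : ℝ) : 0 < (nodeQuad z).eval t := by
  have : (nodeQuad z).eval t = (t - z.re) ^ 2 + z.im ^ 2 := by
    simp [nodeQuad, Complex.normSq_apply]
    ring
  rw [this]
  positivity

theorem natDegree_nodeQuad (z : ℂ) : (nodeQuad z).natDegree = 2 := by
  rw [nodeQuad]; compute_degree!

theorem monic_nodeQuad (z : ℂ) : (nodeQuad z).Monic := by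
  rw [nodeQuad]; monicity!

theorem nodePoly_succ (z : ℕ → ℂ) (n : ℕ) :
    nodePoly z (n + 1) = nodePoly z n * nodeQuad (z n) := Finset.prod_range_succ _ _

theorem natDegree_nodePoly (z : ℕ → ℂ) (n : ℕ) : (nodePoly z n).natDegree = 2 * n := by
  rw [nodePoly, natDegree_prod_of_monic _ _ fun k _ => monic_nodeQuad _]
  simp [natDegree_nodeQuad, mul_comm]

theorem eval_nodePoly_pos {z : ℕ → ℂ} (hz : ∀ k, (z k).im ≠ 0) (n : ℕ) (t : ℝ) :
    0 < (nodePoly z n).eval t := by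
  rw [nodePoly, eval_prod]
  exact Finset.prod_pos fun k _ => eval_nodeQuad_pos (hz k) t

/-! ### Gauss rules for dσ/ω: denominators, numerators and remainders. -/

/-- Nodes `N` and weights `v` of a quadrature formula for `dσ / ω` which is exact on the
polynomials of degree less than `2 n`. -/
structure IsGaussRule (α β : ℝ) (σ : Measure ℝ) (ω : ℝ[X]) (n : ℕ) (N : Finset ℝ) (v : ℝ → ℝ) :
    Prop where
  mem : ∀ x ∈ N, x ∈ Set.Icc α β
  card : N.card = n
  pos : ∀ x ∈ N, 0 < v x
  exact : ∀ p : ℂ[X], p.degree < (2 * n : ℕ) →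
    ∫ t, (((ω.eval t)⁻¹ : ℝ) : ℂ) * p.eval (t : ℂ) ∂σ = ∑ x ∈ N, (v x : ℂ) * p.eval (x : ℂ)

/-- The monic polynomial with simple roots at the points of `N`. -/
def rootPoly (N : Finset ℝ) : ℝ[X] := ∏ x ∈ N, (X - C x)

/-- The numerator of `∑ v x ω(x) / (x - lam)` over the denominator `rootPoly N`. -/
def gaussNum (ω : ℝ[X]) (N : Finset ℝ) (v : ℝ → ℝ) : ℝ[X] :=
  -∑ x ∈ N, C (v x * ω.eval x) * rootPoly (N.erase x)

/-- The function of the second kind. -/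
def secondKind (σ : Measure ℝ) (ω : ℝ[X]) (N : Finset ℝ) (lam : ℂ) : ℂ :=
  ∫ t, (((rootPoly N).eval t * (ω.eval t)⁻¹ : ℝ) : ℂ) * ((t : ℂ) - lam)⁻¹ ∂σ

theorem monic_rootPoly (N : Finset ℝ) : (rootPoly N).Monic :=
  monic_prod_of_monic _ _ fun x _ => monic_X_sub_C x

theorem natDegree_rootPoly (N : Finset ℝ) : (rootPoly N).natDegree = N.card := by
  rw [rootPoly, natDegree_prod_of_monic _ _ fun x _ => monic_X_sub_C x]
  simp

theorem aeval_rootPoly (N : Finset ℝ) (lam : ℂ) :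
    aeval lam (rootPoly N) = ∏ x ∈ N, (lam - x) := by
  simp [rootPoly]

theorem eval_rootPoly_eq_zero {N : Finset ℝ} {x : ℝ} : (rootPoly N).eval x = 0 ↔ x ∈ N := by
  simp [rootPoly, eval_prod, Finset.prod_eq_zero_iff, sub_eq_zero]

theorem rootPoly_dvd {N : Finset ℝ} {p : ℝ[X]} (h : ∀ x ∈ N, p.eval x = 0) : rootPoly N ∣ p := by
  refine Finset.prod_dvd_of_coprime ?_ fun x hx => dvd_iff_isRoot.mpr (h x hx)
  intro x _ y _ hxy
  exact isCoprime_X_sub_C_of_isUnit_sub (sub_ne_zero.mpr hxy).isUnit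

theorem aeval_gaussNum (ω : ℝ[X]) (N : Finset ℝ) (v : ℝ → ℝ) {lam : ℂ}
    (h : ∀ x ∈ N, (x : ℂ) - lam ≠ 0) :
    aeval lam (gaussNum ω N v) =
      aeval lam (rootPoly N) * ∑ x ∈ N, ((v x * ω.eval x : ℝ) : ℂ) * ((x : ℂ) - lam)⁻¹ := by
  rw [gaussNum, map_neg, map_sum, Finset.mul_sum, ← Finset.sum_neg_distrib]
  refine Finset.sum_congr rfl fun x hx => ?_
  have h1 : aeval lam (rootPoly N) = (lam - x) * aeval lam (rootPoly (N.erase x)) := by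
    rw [aeval_rootPoly, aeval_rootPoly, Finset.mul_prod_erase N (fun y : ℝ => lam - (y : ℂ)) hx]
  have h2 := h x hx
  rw [h1, map_mul, aeval_C, Complex.coe_algebraMap]
  field_simp
  ring

theorem degree_gaussNum_lt (ω : ℝ[X]) (N : Finset ℝ) (v : ℝ → ℝ) :
    (gaussNum ω N v).degree < N.card := by
  rw [gaussNum, degree_neg]
  refine (degree_sum_le _ _).trans_lt ?_
  rw [Finset.sup_lt_iff (WithBot.bot_lt_coe _)]
  intro x hx
  have hc : (N.erase x).card < N.card := Finset.card_erase_lt_of_mem hx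
  calc (C (v x * ω.eval x) * rootPoly (N.erase x)).degree
      ≤ (rootPoly (N.erase x)).degree := by
        rw [← smul_eq_C_mul]; exact degree_smul_le _ _
    _ = ((N.erase x).card : WithBot ℕ) := by
        rw [degree_eq_natDegree (monic_rootPoly _).ne_zero, natDegree_rootPoly]
    _ < N.card := by exact_mod_cast hc

/-- At a node only its own summand survives. This makes numerator and denominator coprime. -/
theorem eval_gaussNum_ne_zero {ω : ℝ[X]} {N : Finset ℝ} {v : ℝ → ℝ} (hω : ∀ t, 0 < ω.eval t)
    (hv : ∀ x ∈ N, 0 < v x) {x : ℝ} (hx : x ∈ N) : (gaussNum ω N v).eval x ≠ 0 := by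
  rw [gaussNum, eval_neg, eval_finsetSum, neg_ne_zero, Finset.sum_eq_single x]
  · rw [eval_mul, eval_C]
    refine mul_ne_zero (mul_pos (hv x hx) (hω x)).ne' ?_
    rw [Ne, eval_rootPoly_eq_zero]
    simp
  · intro y hy hyx
    have : (rootPoly (N.erase y)).eval x = 0 :=
      eval_rootPoly_eq_zero.mpr (Finset.mem_erase.mpr ⟨hyx.symm, hx⟩)
    rw [eval_mul, this, mul_zero]
  · exact fun h => absurd hx h

theorem secondKind_conj (σ : Measure ℝ) (ω : ℝ[X]) (N : Finset ℝ) (lam : ℂ) :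
    secondKind σ ω N ((starRingEnd ℂ) lam) = (starRingEnd ℂ) (secondKind σ ω N lam) := by
  rw [secondKind, secondKind, ← integral_conj]
  congr 1 with t
  simp

theorem markovFunction_conj (σ : Measure ℝ) (lam : ℂ) :
    markovFunction σ ((starRingEnd ℂ) lam) = (starRingEnd ℂ) (markovFunction σ lam) := by
  rw [markovFunction, markovFunction, ← integral_conj]
  congr 1 with t
  simp

/-- A root splits off a linear factor and lowers the degree. -/
theorem exists_divided_difference {p : ℂ[X]} {m : ℕ} (hp : p.natDegree ≤ m) {lam : ℂ}
    (h : p.eval lam = 0) :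
    ∃ d : ℂ[X], p = (X - C lam) * d ∧ d.degree < m := by
  obtain ⟨d, hd⟩ := dvd_iff_isRoot.mpr h
  refine ⟨d, hd, ?_⟩
  by_cases hd0 : d = 0
  · rw [hd0, degree_zero]; exact WithBot.bot_lt_coe _
  have : p.natDegree = 1 + d.natDegree := by
    rw [hd, natDegree_mul (X_sub_C_ne_zero _) hd0, natDegree_X_sub_C]
  rw [degree_eq_natDegree hd0]
  exact_mod_cast (by omega : d.natDegree < m)

section
variable {α β : ℝ} {σ : Measure ℝ} [IsFiniteMeasure σ]

theorem continuousOn_inv_eval {ω : ℝ[X]} (hω : ∀ t, 0 < ω.eval t) (s : Set ℝ) :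
    ContinuousOn (fun t => (ω.eval t)⁻¹) s :=
  (Continuous.inv₀ ω.continuous fun t => (hω t).ne').continuousOn

theorem exists_isGaussRule (hσ : σ (Set.Icc α β)ᶜ = 0) (hsupp : σ.support.Infinite)
    {ω : ℝ[X]} (hω : ∀ t, 0 < ω.eval t) (n : ℕ) : ∃ N v, IsGaussRule α β σ ω n N v := by
  obtain ⟨N, v, h1, h2, h3, h4⟩ := exists_gauss_rule_of_weight hσ hsupp
    (continuousOn_inv_eval hω _) (fun t _ => inv_pos.mpr (hω t)) n
  exact ⟨N, v, h1, h2, h3, h4⟩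

theorem aeval_rootPoly_ne_zero {N : Finset ℝ} (hN : ∀ x ∈ N, x ∈ Set.Icc α β) {lam : ℂ}
    (hlam : lam ∈ (complexInterval α β)ᶜ) : aeval lam (rootPoly N) ≠ 0 := by
  rw [aeval_rootPoly, Finset.prod_ne_zero_iff]
  intro x hx h
  exact ofReal_sub_ne_zero hlam (hN x hx) (by rw [← neg_sub, h, neg_zero])

theorem differentiableOn_markovFunction (hσ : σ (Set.Icc α β)ᶜ = 0) :
    DifferentiableOn ℂ (markovFunction σ) (complexInterval α β)ᶜ := by
  have := differentiableOn_integral_mul_inv_sub hσ (h := fun _ => 1) continuousOn_const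
  simp only [one_mul] at this
  exact this

theorem continuousOn_ofReal_eval_mul_inv {ω : ℝ[X]} (hω : ∀ t, 0 < ω.eval t) (p : ℝ[X])
    (s : Set ℝ) : ContinuousOn (fun t => ((p.eval t * (ω.eval t)⁻¹ : ℝ) : ℂ)) s :=
  Complex.continuous_ofReal.comp_continuousOn
    (p.continuous.continuousOn.mul (continuousOn_inv_eval hω s))

theorem differentiableOn_secondKind (hσ : σ (Set.Icc α β)ᶜ = 0) {ω : ℝ[X]}
    (hω : ∀ t, 0 < ω.eval t) (N : Finset ℝ) :
    DifferentiableOn ℂ (secondKind σ ω N) (complexInterval α β)ᶜ :=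
  differentiableOn_integral_mul_inv_sub hσ (continuousOn_ofReal_eval_mul_inv hω _ _)

namespace IsGaussRule
variable {ω : ℝ[X]} {n : ℕ} {N : Finset ℝ} {v : ℝ → ℝ}

/-- With Q = `rootPoly N`, apply exactness to the quotient of Q(lam) ω(t) - ω(lam) Q(t) by t - lam,
which has degree below 2n because deg ω ≤ 2n. The integral gives the terms with φ and the remainder;
in the sum Q vanishes at the nodes and only the numerator is left. -/
theorem rootPoly_mul_markovFunction (h : IsGaussRule α β σ ω n N v)
    (hσ : σ (Set.Icc α β)ᶜ = 0) (hω : ∀ t, 0 < ω.eval t) (hdeg : ω.natDegree ≤ 2 * n)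
    {lam : ℂ} (hlam : lam ∈ (complexInterval α β)ᶜ) :
    aeval lam (rootPoly N) * markovFunction σ lam - aeval lam (gaussNum ω N v) =
      aeval lam ω * secondKind σ ω N lam := by
  let p : ℂ[X] := C (aeval lam (rootPoly N)) * ω.map (algebraMap ℝ ℂ) -
    C (aeval lam ω) * (rootPoly N).map (algebraMap ℝ ℂ)
  have hpd : p.natDegree ≤ 2 * n := by
    refine (natDegree_sub_le _ _).trans (max_le ?_ ?_)
    · exact (natDegree_C_mul_le _ _).trans (natDegree_map_le.trans hdeg)
    · refine (natDegree_C_mul_le _ _).trans (natDegree_map_le.trans ?_)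
      rw [natDegree_rootPoly, h.card]
      omega
  have hp0 : p.eval lam = 0 := by
    simp only [p, eval_sub, eval_mul, eval_C, eval_map_ofReal]
    ring
  obtain ⟨d, hd, hdd⟩ := exists_divided_difference hpd hp0
  have hdt : ∀ t ∈ Set.Icc α β, d.eval (t : ℂ) =
      (aeval lam (rootPoly N) * ((ω.eval t : ℝ) : ℂ) -
        aeval lam ω * (((rootPoly N).eval t : ℝ) : ℂ)) * ((t : ℂ) - lam)⁻¹ := by
    intro t ht
    have h1 := ofReal_sub_ne_zero hlam ht
    have h2 : p.eval (t : ℂ) = ((t : ℂ) - lam) * d.eval (t : ℂ) := by rw [hd]; simp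
    rw [eq_mul_inv_iff_mul_eq₀ h1, mul_comm, ← h2]
    simp only [p, eval_sub, eval_mul, eval_C, eval_map_ofReal, aeval_ofReal_eq]
  have hex := h.exact d hdd
  have hR : ∑ x ∈ N, (v x : ℂ) * d.eval (x : ℂ) = aeval lam (gaussNum ω N v) := by
    rw [aeval_gaussNum ω N v fun x hx => ofReal_sub_ne_zero hlam (h.mem x hx), Finset.mul_sum]
    refine Finset.sum_congr rfl fun x hx => ?_
    rw [hdt x (h.mem x hx), eval_rootPoly_eq_zero.mpr hx]
    push_cast
    ring
  have hL : ∫ t, (((ω.eval t)⁻¹ : ℝ) : ℂ) * d.eval (t : ℂ) ∂σ =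
      aeval lam (rootPoly N) * markovFunction σ lam - aeval lam ω * secondKind σ ω N lam := by
    rw [markovFunction, secondKind, ← integral_const_mul, ← integral_const_mul, ← integral_sub]
    · refine integral_congr_ae ?_
      filter_upwards [ae_mem_Icc hσ] with t ht
      have h1 : ((ω.eval t : ℝ) : ℂ) ≠ 0 := by exact_mod_cast (hω t).ne'
      simp only [hdt t ht]
      push_cast
      field_simp
    · exact (integrable_of_continuousOn_Icc hσ (continuousOn_inv_ofReal_sub hlam)).const_mul _
    · exact (integrable_of_continuousOn_Icc hσ ((continuousOn_ofReal_eval_mul_inv hω _ _).mul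
        (continuousOn_inv_ofReal_sub hlam))).const_mul _
  rw [hL, hR] at hex
  linear_combination hex

/-- Orthogonality of Q to (Q(t) - Q(lam))/(t - lam) turns Q(lam) times the remainder into the
integral of Q²/(ω (t - lam)), which is nonzero off the interval. -/
theorem secondKind_ne_zero (h : IsGaussRule α β σ ω n N v) (hσ : σ (Set.Icc α β)ᶜ = 0)
    (hsupp : σ.support.Infinite) (hω : ∀ t, 0 < ω.eval t)
    {lam : ℂ} (hlam : lam ∈ (complexInterval α β)ᶜ) : secondKind σ ω N lam ≠ 0 := by
  let p : ℂ[X] := (rootPoly N).map (algebraMap ℝ ℂ) - C (aeval lam (rootPoly N))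
  have hpd : p.natDegree ≤ n := by
    refine (natDegree_sub_C).trans_le (natDegree_map_le.trans ?_)
    rw [natDegree_rootPoly, h.card]
  have hp0 : p.eval lam = 0 := by
    simp only [p, eval_sub, eval_C, eval_map_ofReal, sub_self]
  obtain ⟨d, hd, hdd⟩ := exists_divided_difference hpd hp0
  have hdt : ∀ t ∈ Set.Icc α β, d.eval (t : ℂ) =
      ((((rootPoly N).eval t : ℝ) : ℂ) - aeval lam (rootPoly N)) * ((t : ℂ) - lam)⁻¹ := by
    intro t ht
    have h1 := ofReal_sub_ne_zero hlam ht
    have h2 : p.eval (t : ℂ) = ((t : ℂ) - lam) * d.eval (t : ℂ) := by rw [hd]; simp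
    rw [eq_mul_inv_iff_mul_eq₀ h1, mul_comm, ← h2]
    simp only [p, eval_sub, eval_C, eval_map_ofReal, aeval_ofReal_eq]
  have hex := h.exact (d * (rootPoly N).map (algebraMap ℝ ℂ)) (by
    have hR : ((rootPoly N).map (algebraMap ℝ ℂ)).degree = n := by
      rw [degree_map, degree_eq_natDegree (monic_rootPoly _).ne_zero, natDegree_rootPoly, h.card]
    rw [degree_mul, hR]
    by_cases hd0 : d = 0
    · rw [hd0, degree_zero, WithBot.bot_add]; exact WithBot.bot_lt_coe _
    rw [degree_eq_natDegree hd0] at hdd ⊢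
    norm_cast at hdd ⊢
    omega)
  have hR : ∑ x ∈ N, (v x : ℂ) * (d * (rootPoly N).map (algebraMap ℝ ℂ)).eval (x : ℂ) = 0 := by
    refine Finset.sum_eq_zero fun x hx => ?_
    rw [eval_mul, eval_map_ofReal, aeval_ofReal_eq, eval_rootPoly_eq_zero.mpr hx]
    simp
  have hL : ∫ t, (((ω.eval t)⁻¹ : ℝ) : ℂ) *
      (d * (rootPoly N).map (algebraMap ℝ ℂ)).eval (t : ℂ) ∂σ =
      ∫ t, (((ω.eval t)⁻¹ * ‖((rootPoly N).map (algebraMap ℝ ℂ)).eval (t : ℂ)‖ ^ 2 : ℝ) : ℂ) *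
        ((t : ℂ) - lam)⁻¹ ∂σ - aeval lam (rootPoly N) * secondKind σ ω N lam := by
    rw [secondKind, ← integral_const_mul, ← integral_sub]
    · refine integral_congr_ae ?_
      filter_upwards [ae_mem_Icc hσ] with t ht
      simp only [eval_mul, hdt t ht, eval_map_ofReal, aeval_ofReal_eq, Complex.norm_real,
        Real.norm_eq_abs, sq_abs]
      push_cast
      ring
    · refine integrable_of_continuousOn_Icc hσ (ContinuousOn.mul ?_
        (continuousOn_inv_ofReal_sub hlam))
      exact Complex.continuous_ofReal.comp_continuousOn
        ((continuousOn_inv_eval hω _).mul (by fun_prop))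
    · exact (integrable_of_continuousOn_Icc hσ ((continuousOn_ofReal_eval_mul_inv hω _ _).mul
        (continuousOn_inv_ofReal_sub hlam))).const_mul _
  intro h0
  rw [hL, hR, h0, mul_zero, sub_zero] at hex
  refine integral_mul_inv_sub_ne_zero hσ hsupp (continuousOn_inv_eval hω _)
    (fun t _ => inv_pos.mpr (hω t)) ?_ hlam hex
  exact (Polynomial.map_ne_zero_iff (algebraMap ℝ ℂ).injective).mpr (monic_rootPoly N).ne_zero

end IsGaussRule
end

theorem eventually_ne_nhdsNE (x r : ℂ) : ∀ᶠ w in 𝓝[≠] x, w ≠ r := by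
  by_cases hr : r = x
  · rw [hr]; exact self_mem_nhdsWithin
  · exact nhdsWithin_le_nhds (isOpen_ne.mem_nhds (Ne.symm hr))

/-! ### Division by node factors with continuous cofactors. -/

section Division
variable {U : Set ℂ}

theorem exists_eq_X_sub_C_mul (hU : IsOpen U) {W : ℂ[X]} {H : ℂ → ℂ} {r : ℂ} (hr : r ∈ U) (hH : ContinuousOn H U)
    (h : ∀ lam ∈ U, W.eval lam = (lam - r) * H lam) :
    ∃ W' : ℂ[X], W = (X - C r) * W' ∧ ∀ lam ∈ U, W'.eval lam = H lam := by
  obtain ⟨W', hW'⟩ := dvd_iff_isRoot.mpr (show W.IsRoot r by rw [IsRoot, h r hr]; simp)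
  have hne : ∀ lam ∈ U, lam ≠ r → W'.eval lam = H lam := by
    intro lam hl hlr
    have := h lam hl
    rw [hW', eval_mul, eval_sub, eval_X, eval_C] at this
    exact mul_left_cancel₀ (sub_ne_zero.mpr hlr) this
  refine ⟨W', hW', fun lam hl => ?_⟩
  by_cases hlr : lam = r
  · subst hlr
    refine tendsto_nhds_unique_of_eventuallyEq
      (W'.continuous.continuousAt.tendsto.mono_left (nhdsWithin_le_nhds (s := {lam}ᶜ)))
      ((hH.continuousAt (hU.mem_nhds hl)).tendsto.mono_left nhdsWithin_le_nhds) ?_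
    filter_upwards [nhdsWithin_le_nhds (hU.mem_nhds hl), self_mem_nhdsWithin] with x hx hxl
    exact hne x hx hxl
  · exact hne lam hl hlr

/-- Linear factors are removed one at a time, with continuity supplying the value of the cofactor at
each root; repeated nodes therefore need no separate treatment. -/
theorem exists_eq_nodePoly_mul (hU : IsOpen U) {z : ℕ → ℂ} (hz : ∀ k, z k ∈ U)
    (hz' : ∀ k, (starRingEnd ℂ) (z k) ∈ U) (n : ℕ) {W : ℂ[X]} {H : ℂ → ℂ} (hH : ContinuousOn H U)
    (h : ∀ lam ∈ U, W.eval lam = aeval lam (nodePoly z n) * H lam) :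
    ∃ W' : ℂ[X], W = (nodePoly z n).map (algebraMap ℝ ℂ) * W' ∧
      ∀ lam ∈ U, W'.eval lam = H lam := by
  induction n generalizing H with
  | zero => exact ⟨W, by simp [nodePoly], fun lam hl => by simpa [nodePoly] using h lam hl⟩
  | succ n ih =>
    have hc : ContinuousOn (fun lam => (lam - (starRingEnd ℂ) (z n)) * H lam) U :=
      ContinuousOn.mul (by fun_prop) hH
    obtain ⟨W1, hW1, h1⟩ := ih (H := fun lam => (lam - z n) * ((lam - (starRingEnd ℂ) (z n)) *
      H lam)) (ContinuousOn.mul (by fun_prop) hc) (by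
        intro lam hl
        rw [h lam hl, nodePoly_succ, map_mul, aeval_nodeQuad]
        ring)
    obtain ⟨W2, hW2, h2⟩ := exists_eq_X_sub_C_mul hU (hz n) hc h1
    obtain ⟨W3, hW3, h3⟩ := exists_eq_X_sub_C_mul hU (hz' n) hH h2
    refine ⟨W3, ?_, h3⟩
    have hq : (nodeQuad (z n)).map (algebraMap ℝ ℂ) =
        (X - C (z n)) * (X - C ((starRingEnd ℂ) (z n))) := by
      refine Polynomial.funext fun lam => ?_
      rw [eval_map_ofReal, aeval_nodeQuad]
      simp
    rw [hW1, hW2, hW3, nodePoly_succ, Polynomial.map_mul, hq]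
    ring

theorem eqOn_of_nodePoly_mul_eq (hU : IsOpen U) {z : ℕ → ℂ} (hz : ∀ k, z k ∈ U)
    (hz' : ∀ k, (starRingEnd ℂ) (z k) ∈ U) (n : ℕ) {F G : ℂ → ℂ} (hF : ContinuousOn F U)
    (hG : ContinuousOn G U)
    (h : ∀ lam ∈ U, aeval lam (nodePoly z n) * F lam = aeval lam (nodePoly z n) * G lam) :
    ∀ lam ∈ U, F lam = G lam := by
  have hmonic : ((nodePoly z n).map (algebraMap ℝ ℂ)) ≠ 0 :=
    ((monic_prod_of_monic _ _ fun k _ => monic_nodeQuad (z k)).map _).ne_zero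
  obtain ⟨W', hW', h'⟩ := exists_eq_nodePoly_mul hU hz hz' n (W := 0) (hF.sub hG) (by
    intro lam hl
    rw [Pi.sub_apply, mul_sub, h lam hl, sub_self, eval_zero])
  have : W' = 0 := by
    rcases mul_eq_zero.mp hW'.symm with h0 | h0
    · exact absurd h0 hmonic
    · exact h0
  intro lam hl
  have h0 := h' lam hl
  rw [this, eval_zero, Pi.sub_apply] at h0
  exact (sub_eq_zero.mp h0.symm)

end Division

/-! ### Padé systems and their three-term recurrence. -/

theorem degree_mul_lt_of_le_of_lt {R : Type*} [CommRing R] {p q : R[X]} {m n : ℕ}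
    (hp : p.degree ≤ m)
    (hq : q.degree < n) : (p * q).degree < (m + n : ℕ) := by
  by_cases hq0 : q = 0
  · rw [hq0, mul_zero, degree_zero]; exact WithBot.bot_lt_coe _
  by_cases hp0 : p = 0
  · rw [hp0, zero_mul, degree_zero]; exact WithBot.bot_lt_coe _
  refine (degree_mul_le _ _).trans_lt ?_
  rw [degree_eq_natDegree hp0] at hp ⊢
  rw [degree_eq_natDegree hq0] at hq ⊢
  norm_cast at hp hq ⊢
  omega

/-- Numerators `P n` and denominators `Q n` of diagonal multipoint Padé approximants of `φ`, with
the normalized remainders `E n`. -/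
structure IsPadeSystem (α β : ℝ) (φ : ℂ → ℂ) (z : ℕ → ℂ) (Q P : ℕ → ℝ[X]) (E : ℕ → ℂ → ℂ) :
    Prop where
  remainder : ∀ n, ∀ lam ∈ (complexInterval α β)ᶜ,
    aeval lam (Q n) * φ lam - aeval lam (P n) = aeval lam (nodePoly z n) * E n lam
  continuousOn : ∀ n, ContinuousOn (E n) (complexInterval α β)ᶜ
  remainder_ne_zero : ∀ n, ∀ lam ∈ (complexInterval α β)ᶜ, E n lam ≠ 0
  remainder_conj : ∀ n lam, E n ((starRingEnd ℂ) lam) = (starRingEnd ℂ) (E n lam)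
  denom_ne_zero : ∀ n, ∀ lam ∈ (complexInterval α β)ᶜ, aeval lam (Q n) ≠ 0
  monic : ∀ n, (Q n).Monic
  natDegree : ∀ n, (Q n).natDegree = n
  degree_lt : ∀ n, (P n).degree < n
  dvd_of_dvd_mul : ∀ n A, Q n ∣ A * P n → Q n ∣ A

/-- The shift of a sequence of numerators or denominators, multiplied by the node factors. -/
def shiftPoly (z : ℕ → ℂ) (Q : ℕ → ℝ[X]) (q : ℝ[X]) : ℕ → ℝ[X]
  | 0 => q
  | j + 1 => nodeQuad (z j) * Q j

/-- The shift of the sequence of remainders. -/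
def shiftFun (E : ℕ → ℂ → ℂ) : ℕ → ℂ → ℂ
  | 0 => 1
  | j + 1 => E j

/-- The linear polynomial `a⁽²⁾_j X - a⁽¹⁾_j`. -/
def linPoly (φ : ℂ → ℂ) (z : ℕ → ℂ) (b : ℕ → ℝ) (j : ℕ) : ℝ[X] :=
  C (stepA2 (stepFun φ z b j) (z j)) * X - C (stepA1 (stepFun φ z b j) (z j))

theorem degree_linPoly_le (φ : ℂ → ℂ) (z : ℕ → ℂ) (b : ℕ → ℝ) (j : ℕ) :
    (linPoly φ z b j).degree ≤ (1 : ℕ) := by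
  rw [linPoly]; compute_degree; norm_num

theorem coe_stepA1 {φ : ℂ → ℂ} {z : ℂ} (hz : z.im ≠ 0) :
    (stepA1 φ z : ℂ) = (stepA2 φ z : ℂ) * z + (φ z)⁻¹ := by
  refine Complex.ext (by simp [stepA1]) ?_
  simp only [Complex.ofReal_im, Complex.add_im, Complex.im_ofReal_mul, stepA2]
  field_simp
  ring

theorem aeval_linPoly (φ : ℂ → ℂ) (z : ℕ → ℂ) (b : ℕ → ℝ) (j : ℕ) (lam : ℂ) :
    aeval lam (linPoly φ z b j) = (stepA2 (stepFun φ z b j) (z j) : ℂ) * lam -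
      (stepA1 (stepFun φ z b j) (z j) : ℂ) := by
  simp [linPoly]

namespace IsPadeSystem
variable {α β : ℝ} {φ : ℂ → ℂ} {z : ℕ → ℂ} {Q P : ℕ → ℝ[X]} {E : ℕ → ℂ → ℂ}

theorem denom_zero (h : IsPadeSystem α β φ z Q P E) : Q 0 = 1 :=
  (h.monic 0).natDegree_eq_zero.mp (h.natDegree 0)

theorem num_zero (h : IsPadeSystem α β φ z Q P E) : P 0 = 0 := by
  have := h.degree_lt 0
  rw [← degree_eq_bot]
  exact Nat.WithBot.lt_zero_iff.mp (by simpa using this)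

theorem eq_remainder_zero (h : IsPadeSystem α β φ z Q P E) {lam : ℂ}
    (hlam : lam ∈ (complexInterval α β)ᶜ) : φ lam = E 0 lam := by
  have := h.remainder 0 lam hlam
  simpa [h.denom_zero, h.num_zero, nodePoly] using this

theorem degree_denom (h : IsPadeSystem α β φ z Q P E) (n : ℕ) : (Q n).degree = n := by
  rw [degree_eq_natDegree (h.monic n).ne_zero, h.natDegree]

theorem degree_shift_denom_le (h : IsPadeSystem α β φ z Q P E) (j : ℕ) :
    (shiftPoly z Q 0 j).degree ≤ (j + 1 : ℕ) := by
  cases j with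
  | zero => simp [shiftPoly]
  | succ i =>
    rw [shiftPoly, degree_mul, h.degree_denom, degree_eq_natDegree (monic_nodeQuad _).ne_zero,
      natDegree_nodeQuad]
    norm_cast
    omega

theorem degree_shift_num_lt (h : IsPadeSystem α β φ z Q P E) (j : ℕ) :
    (shiftPoly z P (-1) j).degree < (j + 1 : ℕ) := by
  cases j with
  | zero => simp [shiftPoly, degree_neg]
  | succ i =>
    have h1 : (nodeQuad (z i)).degree ≤ (2 : ℕ) := by
      rw [degree_eq_natDegree (monic_nodeQuad _).ne_zero, natDegree_nodeQuad]
    have := degree_mul_lt_of_le_of_lt h1 (h.degree_lt i)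
    rw [add_comm 2 i] at this
    exact this

/-- Index j carries the pair of index j - 1 times one quadratic factor, so that both terms of the
recurrence contain the full ω_j. At j = 0 the initial pair (0, -1) has the remainder 0·φ + 1 = 1. -/
theorem shift_remainder (h : IsPadeSystem α β φ z Q P E) (j : ℕ) {lam : ℂ}
    (hlam : lam ∈ (complexInterval α β)ᶜ) :
    aeval lam (shiftPoly z Q 0 j) * φ lam - aeval lam (shiftPoly z P (-1) j) =
      aeval lam (nodePoly z j) * shiftFun E j lam := by
  cases j with
  | zero => simp [shiftPoly, shiftFun, nodePoly]
  | succ i =>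
    have := h.remainder i lam hlam
    simp only [shiftPoly, shiftFun, nodePoly_succ, map_mul]
    linear_combination aeval lam (nodeQuad (z i)) * this

theorem shift_ne_zero (h : IsPadeSystem α β φ z Q P E) (j : ℕ) {lam : ℂ}
    (hlam : lam ∈ (complexInterval α β)ᶜ) : shiftFun E j lam ≠ 0 := by
  cases j with
  | zero => simp [shiftFun]
  | succ i => exact h.remainder_ne_zero i lam hlam

theorem shift_conj (h : IsPadeSystem α β φ z Q P E) (j : ℕ) (lam : ℂ) :
    shiftFun E j ((starRingEnd ℂ) lam) = (starRingEnd ℂ) (shiftFun E j lam) := by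
  cases j with
  | zero => simp [shiftFun]
  | succ i => exact h.remainder_conj i lam

theorem continuousOn_shift (h : IsPadeSystem α β φ z Q P E) (j : ℕ) :
    ContinuousOn (shiftFun E j) (complexInterval α β)ᶜ := by
  cases j with
  | zero => exact continuousOn_const
  | succ i => exact h.continuousOn i

/-- A combination of `φ` and `1` with the degrees and zeros of the `n`-th remainder is a constant
multiple of it. -/
theorem eq_C_mul (h : IsPadeSystem α β φ z Q P E) (hz : ∀ k, (z k).im ≠ 0) {j : ℕ} {A B : ℝ[X]}
    (hA : A.degree ≤ (j + 1 : ℕ)) (hB : B.degree < (j + 1 : ℕ)) {T : ℂ → ℂ}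
    (hT : ContinuousOn T (complexInterval α β)ᶜ)
    (hAB : ∀ lam ∈ (complexInterval α β)ᶜ,
      aeval lam A * φ lam - aeval lam B = aeval lam (nodePoly z j) * T lam)
    (hT1 : T (z j) = 0) (hT2 : T ((starRingEnd ℂ) (z j)) = 0) :
    ∃ c : ℝ, A = C c * Q (j + 1) ∧ B = C c * P (j + 1) := by
  have hU := isOpen_compl_complexInterval (α := α) (β := β)
  have hzU : ∀ k, z k ∈ (complexInterval α β)ᶜ :=
    fun k => mem_compl_complexInterval_of_im (hz k)
  have hzU' : ∀ k, (starRingEnd ℂ) (z k) ∈ (complexInterval α β)ᶜ :=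
    fun k => conj_mem_compl_complexInterval (hzU k)
  set W : ℝ[X] := A * P (j + 1) - B * Q (j + 1) with hW
  have hWdeg : W.degree < (2 * (j + 1) : ℕ) := by
    have h1 := degree_mul_lt_of_le_of_lt hA (h.degree_lt (j + 1))
    have h2 := degree_mul_lt_of_le_of_lt (h.degree_denom (j + 1)).le hB
    rw [mul_comm] at h2
    rw [two_mul]
    exact (degree_sub_le _ _).trans_lt (max_lt h1 h2)
  -- W is divisible by ω_j through the two remainder formulas, and the cofactor vanishes at z_j and
  -- conj z_j as well; this makes 2j + 2 zeros for a degree below 2j + 2.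
  have hW0 : W = 0 := by
    let H : ℂ → ℂ := fun lam => aeval lam (Q (j + 1)) * T lam -
      aeval lam A * (aeval lam (nodeQuad (z j)) * E (j + 1) lam)
    have hH : ContinuousOn H (complexInterval α β)ᶜ :=
      ((continuous_aeval_complex _).continuousOn.mul hT).sub
        ((continuous_aeval_complex _).continuousOn.mul
          ((continuous_aeval_complex _).continuousOn.mul (h.continuousOn _)))
    obtain ⟨W1, hW1, h1⟩ := exists_eq_nodePoly_mul hU hzU hzU' j
      (W := W.map (algebraMap ℝ ℂ)) hH (by
        intro lam hl
        have e1 := hAB lam hl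
        have e2 := h.remainder (j + 1) lam hl
        rw [nodePoly_succ, map_mul] at e2
        simp only [hW, H, eval_map_ofReal, map_sub, map_mul]
        linear_combination aeval lam (Q (j + 1)) * e1 - aeval lam A * e2)
    have r1 : W1.IsRoot (z j) := by
      rw [IsRoot, h1 _ (hzU j)]
      simp [H, hT1, aeval_nodeQuad]
    have r2 : W1.IsRoot ((starRingEnd ℂ) (z j)) := by
      rw [IsRoot, h1 _ (hzU' j)]
      simp [H, hT2, aeval_nodeQuad]
    have hne : z j ≠ (starRingEnd ℂ) (z j) := fun e => hz j (Complex.conj_eq_iff_im.mp e.symm)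
    obtain ⟨W2, hW2⟩ := (isCoprime_X_sub_C_of_isUnit_sub
      (sub_ne_zero.mpr hne).isUnit).mul_dvd (dvd_iff_isRoot.mpr r1) (dvd_iff_isRoot.mpr r2)
    by_contra hne0
    have hne1 : W.map (algebraMap ℝ ℂ) ≠ 0 :=
      (Polynomial.map_ne_zero_iff (algebraMap ℝ ℂ).injective).mpr hne0
    have hW20 : W2 ≠ 0 := by rintro rfl; simp [hW1, hW2] at hne1
    have hω : (nodePoly z j).map (algebraMap ℝ ℂ) ≠ 0 := by
      intro h0; simp [hW1, h0] at hne1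
    have hd : (W.map (algebraMap ℝ ℂ)).natDegree = 2 * j + (1 + 1 + W2.natDegree) := by
      rw [hW1, hW2, natDegree_mul hω, natDegree_mul _ hW20, natDegree_mul, natDegree_X_sub_C,
        natDegree_X_sub_C, natDegree_map, natDegree_nodePoly]
      · exact X_sub_C_ne_zero _
      · exact X_sub_C_ne_zero _
      · exact mul_ne_zero (X_sub_C_ne_zero _) (X_sub_C_ne_zero _)
      · exact mul_ne_zero (mul_ne_zero (X_sub_C_ne_zero _) (X_sub_C_ne_zero _)) hW20
    rw [natDegree_map] at hd
    rw [degree_eq_natDegree hne0] at hWdeg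
    norm_cast at hWdeg
    omega
  have hmul : A * P (j + 1) = B * Q (j + 1) := sub_eq_zero.mp hW0
  obtain ⟨D, hD⟩ := h.dvd_of_dvd_mul (j + 1) A ⟨B, by rw [hmul, mul_comm]⟩
  have hDdeg : D.degree ≤ 0 := by
    by_cases hD0 : D = 0
    · simp [hD0]
    rw [hD, degree_mul, h.degree_denom, degree_eq_natDegree hD0] at hA
    rw [degree_eq_natDegree hD0]
    norm_cast at hA ⊢
    omega
  obtain ⟨c, rfl⟩ : ∃ c, D = C c := ⟨_, eq_C_of_degree_le_zero hDdeg⟩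
  refine ⟨c, by rw [hD, mul_comm], ?_⟩
  have := hmul
  rw [hD] at this
  refine mul_right_cancel₀ (h.monic (j + 1)).ne_zero ?_
  rw [← this]
  ring

/-- One induction step for φ_j = c_j E_j / E_{j-1}: the right-hand sides form a pair with the
degrees and zeros of the pair of index j + 1, hence are a constant multiple d of it, and c_{j+1} = d
/ (b_j² c_j). -/
theorem exists_step (h : IsPadeSystem α β φ z Q P E) (hz : ∀ k, (z k).im ≠ 0) {b : ℕ → ℝ}
    (hb : ∀ j, b j ≠ 0) {j : ℕ} {c : ℝ} (hc : c ≠ 0)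
    (hS : ∀ lam ∈ (complexInterval α β)ᶜ, stepFun φ z b j lam * shiftFun E j lam = c * E j lam) :
    ∃ c' : ℝ, c' ≠ 0 ∧
      (∀ lam ∈ (complexInterval α β)ᶜ,
        stepFun φ z b (j + 1) lam * shiftFun E (j + 1) lam = c' * E (j + 1) lam) ∧
      C (b j ^ 2 * c * c') * Q (j + 1) =
        -shiftPoly z Q 0 j - C c * linPoly φ z b j * Q j ∧
      C (b j ^ 2 * c * c') * P (j + 1) =
        -shiftPoly z P (-1) j - C c * linPoly φ z b j * P j := by
  have hU := isOpen_compl_complexInterval (α := α) (β := β)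
  have hzU : ∀ k, z k ∈ (complexInterval α β)ᶜ :=
    fun k => mem_compl_complexInterval_of_im (hz k)
  have hzU' : ∀ k, (starRingEnd ℂ) (z k) ∈ (complexInterval α β)ᶜ :=
    fun k => conj_mem_compl_complexInterval (hzU k)
  have hcC : (c : ℂ) ≠ 0 := by exact_mod_cast hc
  have hbC : (b j : ℂ) ≠ 0 := by exact_mod_cast hb j
  have hinv : ∀ lam ∈ (complexInterval α β)ᶜ,
      (stepFun φ z b j lam)⁻¹ * (c * E j lam) = shiftFun E j lam := by
    intro lam hl
    have h1 := h.shift_ne_zero j hl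
    have h2 := mul_ne_zero hcC (h.remainder_ne_zero j lam hl)
    have h3 : stepFun φ z b j lam ≠ 0 := by
      intro h0
      rw [← hS lam hl, h0, zero_mul] at h2
      exact h2 rfl
    rw [← hS lam hl, inv_mul_cancel_left₀ h3]
  let T : ℂ → ℂ := fun lam => -shiftFun E j lam - c * aeval lam (linPoly φ z b j) * E j lam
  have hT : ContinuousOn T (complexInterval α β)ᶜ :=
    (h.continuousOn_shift j).neg.sub ((continuousOn_const.mul
      (continuous_aeval_complex _).continuousOn).mul (h.continuousOn j))
  have hlin1 : aeval (z j) (linPoly φ z b j) = -(stepFun φ z b j (z j))⁻¹ := by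
    rw [aeval_linPoly, coe_stepA1 (hz j)]
    ring
  have hT1 : T (z j) = 0 := by
    simp only [T, hlin1]
    linear_combination hinv _ (hzU j)
  -- T is symmetric under conjugation because the coefficients are real.
  have hT2 : T ((starRingEnd ℂ) (z j)) = 0 := by
    have : T ((starRingEnd ℂ) (z j)) = (starRingEnd ℂ) (T (z j)) := by
      simp only [T, h.shift_conj, h.remainder_conj, aeval_conj, map_sub, map_neg, map_mul,
        Complex.conj_ofReal]
    rw [this, hT1, map_zero]
  set A : ℝ[X] := -shiftPoly z Q 0 j - C c * linPoly φ z b j * Q j with hA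
  set B : ℝ[X] := -shiftPoly z P (-1) j - C c * linPoly φ z b j * P j with hB
  have hclin : (C c * linPoly φ z b j).degree ≤ (1 : ℕ) := by
    rw [← smul_eq_C_mul]
    exact (degree_smul_le _ _).trans (degree_linPoly_le _ _ _ _)
  have hAd : A.degree ≤ (j + 1 : ℕ) := by
    refine (degree_sub_le _ _).trans (max_le ?_ ?_)
    · rw [degree_neg]; exact h.degree_shift_denom_le j
    · refine (degree_mul_le _ _).trans ((add_le_add hclin (h.degree_denom j).le).trans ?_)
      norm_cast
      omega
  have hBd : B.degree < (j + 1 : ℕ) := by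
    refine (degree_sub_le _ _).trans_lt (max_lt ?_ ?_)
    · rw [degree_neg]; exact h.degree_shift_num_lt j
    · rw [add_comm]; exact degree_mul_lt_of_le_of_lt hclin (h.degree_lt j)
  have hAB : ∀ lam ∈ (complexInterval α β)ᶜ,
      aeval lam A * φ lam - aeval lam B = aeval lam (nodePoly z j) * T lam := by
    intro lam hl
    have e1 := h.shift_remainder j hl
    have e2 := h.remainder j lam hl
    simp only [hA, hB, T, map_sub, map_neg, map_mul, aeval_C, Complex.coe_algebraMap]
    linear_combination -e1 - c * aeval lam (linPoly φ z b j) * e2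
  obtain ⟨d, hdA, hdB⟩ := h.eq_C_mul hz hAd hBd hT hAB hT1 hT2
  -- For j = 0 the vanishing pair would have B = 1. For j = i + 1, evaluating A = 0 at z_i gives the
  -- real linear polynomial a nonreal zero, since Q does not vanish there; so it is zero, and then a
  -- product of monic polynomials would vanish.
  have hd : d ≠ 0 := by
    rintro rfl
    rw [C_0, zero_mul] at hdA hdB
    cases j with
    | zero => simp [hB, shiftPoly, h.num_zero] at hdB
    | succ i =>
      simp only [hA, shiftPoly] at hdA
      have e := congrArg (aeval (z i)) hdA
      simp only [map_sub, map_neg, map_mul, aeval_nodeQuad, sub_self, zero_mul, neg_zero, zero_sub,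
        map_zero, aeval_C, Complex.coe_algebraMap, neg_eq_zero] at e
      have e1 : aeval (z i) (linPoly φ z b (i + 1)) = 0 := by
        simpa [hc, h.denom_ne_zero (i + 1) _ (hzU i)] using e
      rw [aeval_linPoly] at e1
      have e2 : stepA2 (stepFun φ z b (i + 1)) (z (i + 1)) = 0 := by
        have := congrArg Complex.im e1
        simpa [hz i] using this
      have e3 : stepA1 (stepFun φ z b (i + 1)) (z (i + 1)) = 0 := by
        simpa [e2] using e1
      have e4 : linPoly φ z b (i + 1) = 0 := by simp [linPoly, e2, e3]
      rw [e4, mul_zero, zero_mul, sub_zero, neg_eq_zero] at hdA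
      exact ((monic_nodeQuad (z i)).mul (h.monic i)).ne_zero hdA
  have hTE : ∀ lam ∈ (complexInterval α β)ᶜ,
      T lam = d * (aeval lam (nodeQuad (z j)) * E (j + 1) lam) := by
    refine eqOn_of_nodePoly_mul_eq hU hzU hzU' j hT (continuousOn_const.mul
      ((continuous_aeval_complex _).continuousOn.mul (h.continuousOn _))) ?_
    intro lam hl
    have e2 := h.remainder (j + 1) lam hl
    rw [nodePoly_succ, map_mul] at e2
    have e1 := hAB lam hl
    rw [hdA, hdB] at e1
    simp only [map_mul, aeval_C, Complex.coe_algebraMap] at e1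
    linear_combination -e1 + d * e2
  have hdc : b j ^ 2 * c * (d / (b j ^ 2 * c)) = d := by
    have := hb j
    field_simp
  refine ⟨d / (b j ^ 2 * c), div_ne_zero hd (mul_ne_zero (pow_ne_zero 2 (hb j)) hc), ?_,
    by rw [hdc, hdA], by rw [hdc, hdB]⟩
  intro lam hl
  have hEl := h.remainder_ne_zero j lam hl
  -- On a punctured neighbourhood the step formula equals a quotient continuous at lam, because E_j
  -- has no zeros; so the limit is its value, also at z_j and conj z_j.
  have hlim : stepFun φ z b (j + 1) lam =
      ((d / (b j ^ 2 * c) : ℝ) : ℂ) * (E (j + 1) lam / E j lam) := by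
    rw [stepFun, stepNext]
    apply Tendsto.limUnder_eq
    have hcont : ContinuousAt (fun w => ((d / (b j ^ 2 * c) : ℝ) : ℂ) * (E (j + 1) w / E j w))
        lam :=
      continuousAt_const.mul (((h.continuousOn (j + 1)).continuousAt (hU.mem_nhds hl)).div
        ((h.continuousOn j).continuousAt (hU.mem_nhds hl)) hEl)
    refine (hcont.tendsto.mono_left nhdsWithin_le_nhds).congr' ?_
    filter_upwards [nhdsWithin_le_nhds (hU.mem_nhds hl), eventually_ne_nhdsNE lam (z j),
      eventually_ne_nhdsNE lam ((starRingEnd ℂ) (z j))] with w hw hw1 hw2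
    have g1 := hinv w hw
    have g2 := hTE w hw
    have g3 := h.remainder_ne_zero j w hw
    have g4 : w - z j ≠ 0 := sub_ne_zero.mpr hw1
    have g5 : w - (starRingEnd ℂ) (z j) ≠ 0 := sub_ne_zero.mpr hw2
    simp only [T, aeval_linPoly, aeval_nodeQuad] at g2
    rw [← g1] at g2
    push_cast
    rw [eq_div_iff (mul_ne_zero (mul_ne_zero (pow_ne_zero 2 hbC) g4) g5), ← sub_eq_zero]
    have key : ((c : ℂ) * E j w) * (d / (b j ^ 2 * c) * (E (j + 1) w / E j w) *
        (b j ^ 2 * (w - z j) * (w - (starRingEnd ℂ) (z j)))) =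
        d * ((w - z j) * (w - (starRingEnd ℂ) (z j)) * E (j + 1) w) := by
      field_simp
    refine (mul_eq_zero.mp ?_).resolve_left (mul_ne_zero hcC g3)
    rw [mul_sub, key]
    linear_combination -g2
  rw [hlim, shiftFun]
  field_simp

/-- The functions of the step-by-step process are quotients of consecutive remainders, which
gives the three-term recurrence relations. -/
theorem exists_recurrence (h : IsPadeSystem α β φ z Q P E) (hz : ∀ k, (z k).im ≠ 0) {b : ℕ → ℝ}
    (hb : ∀ j, b j ≠ 0) :
    ∃ c : ℕ → ℝ, c 0 = 1 ∧ (∀ j, c j ≠ 0) ∧ ∀ j,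
      C (b j ^ 2 * c j * c (j + 1)) * Q (j + 1) =
        -shiftPoly z Q 0 j - C (c j) * linPoly φ z b j * Q j ∧
      C (b j ^ 2 * c j * c (j + 1)) * P (j + 1) =
        -shiftPoly z P (-1) j - C (c j) * linPoly φ z b j * P j := by
  let S : ℕ → ℝ → Prop := fun j c => c ≠ 0 ∧ ∀ lam ∈ (complexInterval α β)ᶜ,
    stepFun φ z b j lam * shiftFun E j lam = c * E j lam
  have h0 : S 0 1 := ⟨one_ne_zero, fun lam hl => by
    simp [stepFun, shiftFun, h.eq_remainder_zero hl]⟩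
  have hstep : ∀ j c, S j c → ∃ c', S (j + 1) c' ∧
      C (b j ^ 2 * c * c') * Q (j + 1) = -shiftPoly z Q 0 j - C c * linPoly φ z b j * Q j ∧
      C (b j ^ 2 * c * c') * P (j + 1) =
        -shiftPoly z P (-1) j - C c * linPoly φ z b j * P j := by
    intro j c hS
    obtain ⟨c', h1, h2, h3, h4⟩ := h.exists_step hz hb hS.1 hS.2
    exact ⟨c', ⟨h1, h2⟩, h3, h4⟩
  choose! f hf1 hf2 using hstep
  let c : ℕ → ℝ := fun j => Nat.rec 1 (fun j c => f j c) j
  have hc : ∀ j, S j (c j) := fun j => by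
    induction j with
    | zero => exact h0
    | succ j ih => exact hf1 j _ ih
  exact ⟨c, rfl, fun j => (hc j).1, fun j => hf2 j _ (hc j)⟩

end IsPadeSystem

/-! ### The convergents as quotients of the Padé polynomials. -/

/-- A real polynomial as a complex rational function. -/
def toRatFunc : ℝ[X] →+* RatFunc ℂ :=
  (algebraMap ℂ[X] (RatFunc ℂ)).comp (mapRingHom (algebraMap ℝ ℂ))

theorem toRatFunc_apply (p : ℝ[X]) :
    toRatFunc p = algebraMap ℂ[X] (RatFunc ℂ) (p.map (algebraMap ℝ ℂ)) := rfl

theorem toRatFunc_ne_zero {p : ℝ[X]} (hp : p ≠ 0) : toRatFunc p ≠ 0 := by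
  rw [toRatFunc_apply]
  exact RatFunc.algebraMap_ne_zero
    ((Polynomial.map_ne_zero_iff (algebraMap ℝ ℂ).injective).mpr hp)

theorem toRatFunc_C (r : ℝ) : toRatFunc (C r) = RatFunc.C (r : ℂ) := by
  rw [toRatFunc_apply, map_C, RatFunc.algebraMap_C, Complex.coe_algebraMap]

theorem toRatFunc_linPoly (φ : ℂ → ℂ) (z : ℕ → ℂ) (b : ℕ → ℝ) (j : ℕ) :
    toRatFunc (linPoly φ z b j) = linearTerm φ z b j := by
  rw [linPoly, linearTerm, map_sub, map_mul, toRatFunc_C, toRatFunc_C, toRatFunc_apply, map_X,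
    RatFunc.algebraMap_X]

theorem toRatFunc_nodeQuad (z : ℂ) :
    toRatFunc (nodeQuad z) =
      (RatFunc.X - RatFunc.C z) * (RatFunc.X - RatFunc.C ((starRingEnd ℂ) z)) := by
  have : (nodeQuad z).map (algebraMap ℝ ℂ) = (X - C z) * (X - C ((starRingEnd ℂ) z)) := by
    refine Polynomial.funext fun lam => ?_
    rw [eval_map_ofReal, aeval_nodeQuad]
    simp
  rw [toRatFunc_apply, this, map_mul, map_sub, map_sub, RatFunc.algebraMap_X,
    RatFunc.algebraMap_C, RatFunc.algebraMap_C]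

namespace IsPadeSystem
variable {α β : ℝ} {φ : ℂ → ℂ} {z : ℕ → ℂ} {Q P : ℕ → ℝ[X]} {E : ℕ → ℂ → ℂ}

/-- Otherwise coprimality would force Q_M to divide Q_j, of smaller degree. -/
theorem cross_ne_zero (h : IsPadeSystem α β φ z Q P E) {j M : ℕ} (hj : j < M) :
    Q j * P M - P j * Q M ≠ 0 := by
  intro h0
  have hd : Q M ∣ Q j := h.dvd_of_dvd_mul M (Q j) ⟨P j, by rw [sub_eq_zero.mp h0, mul_comm]⟩
  have := natDegree_le_of_dvd hd (h.monic j).ne_zero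
  rw [h.natDegree, h.natDegree] at this
  omega

/-- Off the zeros of ω_j, φ_j is c_j (Q_j φ - P_j) divided by the shifted remainder; the right-hand
side is this expression with φ replaced by P_M/Q_M, M = n + j + 1. The recurrence carries it from j
+ 1 to j, and the fraction stops because the cross product of index M with itself is zero. At j = 0
it reduces to c_0 P_M/Q_M. -/
theorem tailFraction_eq (h : IsPadeSystem α β φ z Q P E) {b c : ℕ → ℝ} (hc : ∀ j, c j ≠ 0)
    (hrec : ∀ j,
      C (b j ^ 2 * c j * c (j + 1)) * Q (j + 1) =
        -shiftPoly z Q 0 j - C (c j) * linPoly φ z b j * Q j ∧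
      C (b j ^ 2 * c j * c (j + 1)) * P (j + 1) =
        -shiftPoly z P (-1) j - C (c j) * linPoly φ z b j * P j) (n j : ℕ) :
    tailFraction φ z b n j =
      toRatFunc (C (c j) * (Q j * P (n + j + 1) - P j * Q (n + j + 1))) /
        toRatFunc (shiftPoly z Q 0 j * P (n + j + 1) - shiftPoly z P (-1) j * Q (n + j + 1)) := by
  have hshift : ∀ M j, j < M →
      toRatFunc (shiftPoly z Q 0 j * P M - shiftPoly z P (-1) j * Q M) ≠ 0 := by
    intro M j hj
    refine toRatFunc_ne_zero ?_
    cases j with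
    | zero => simpa [shiftPoly] using (h.monic M).ne_zero
    | succ i =>
      have : shiftPoly z Q 0 (i + 1) * P M - shiftPoly z P (-1) (i + 1) * Q M =
          nodeQuad (z i) * (Q i * P M - P i * Q M) := by
        simp only [shiftPoly]; ring
      rw [this]
      exact mul_ne_zero (monic_nodeQuad _).ne_zero (h.cross_ne_zero (by omega))
  have hcross : ∀ M j, C (b j ^ 2 * c j * c (j + 1)) * (Q (j + 1) * P M - P (j + 1) * Q M) =
      -(shiftPoly z Q 0 j * P M - shiftPoly z P (-1) j * Q M) -
        C (c j) * linPoly φ z b j * (Q j * P M - P j * Q M) := by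
    intro M j
    linear_combination P M * (hrec j).1 - Q M * (hrec j).2
  induction n generalizing j with
  | zero =>
    have h1 := hcross (0 + j + 1) j
    rw [zero_add, mul_comm (P (j + 1)), sub_self, mul_zero] at h1
    have h2 : shiftPoly z Q 0 j * P (j + 1) - shiftPoly z P (-1) j * Q (j + 1) =
        -(linPoly φ z b j * (C (c j) * (Q j * P (j + 1) - P j * Q (j + 1)))) := by
      linear_combination h1
    have h3 := hshift (j + 1) j (by omega)
    rw [zero_add, h2]
    rw [h2, map_neg, map_mul, neg_ne_zero] at h3
    have h4 := left_ne_zero_of_mul h3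
    have h5 := right_ne_zero_of_mul h3
    rw [tailFraction, map_neg, map_mul toRatFunc (linPoly φ z b j), ← toRatFunc_linPoly]
    generalize toRatFunc (C (c j) * (Q j * P (j + 1) - P j * Q (j + 1))) = K at h5 ⊢
    field_simp
  | succ n ih =>
    have e : n + (j + 1) + 1 = n + 1 + j + 1 := by ring
    have ih' := ih (j + 1)
    rw [e] at ih'
    set M := n + 1 + j + 1 with hM
    have hU := toRatFunc_ne_zero (h.cross_ne_zero (show j < M by omega))
    have hS := hshift M j (by omega)
    have hS1 : shiftPoly z Q 0 (j + 1) * P M - shiftPoly z P (-1) (j + 1) * Q M =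
        nodeQuad (z j) * (Q j * P M - P j * Q M) := by
      simp only [shiftPoly]; ring
    have hq := toRatFunc_ne_zero (monic_nodeQuad (z j)).ne_zero
    have hcj := toRatFunc_ne_zero (C_ne_zero.mpr (hc j))
    have hcr := congrArg toRatFunc (hcross M j)
    rw [tailFraction, ih', hS1, ← toRatFunc_linPoly,
      mul_assoc (RatFunc.C ((b j : ℂ) ^ 2)), ← toRatFunc_nodeQuad,
      show RatFunc.C ((b j : ℂ) ^ 2) = toRatFunc (C (b j ^ 2)) by rw [toRatFunc_C]; push_cast; rfl]
    simp only [map_mul, map_neg, map_sub toRatFunc (-_)] at hcr ⊢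
    set S := toRatFunc (shiftPoly z Q 0 j * P M - shiftPoly z P (-1) j * Q M)
    set U := toRatFunc (Q j * P M - P j * Q M)
    set V := toRatFunc (Q (j + 1) * P M - P (j + 1) * Q M)
    set l := toRatFunc (linPoly φ z b j)
    set q := toRatFunc (nodeQuad (z j))
    set c0 := toRatFunc (C (c j))
    set c1 := toRatFunc (C (c (j + 1)))
    set b2 := toRatFunc (C (b j ^ 2))
    have hden : c0 * U * (l + b2 * q * (c1 * V / (q * U))) = -S := by
      field_simp
      linear_combination hcr
    have hD : l + b2 * q * (c1 * V / (q * U)) ≠ 0 := by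
      intro h0
      rw [h0, mul_zero] at hden
      exact hS (neg_eq_zero.mp hden.symm)
    rw [div_eq_div_iff hD hS]
    linear_combination -hden

theorem convergent_eq (h : IsPadeSystem α β φ z Q P E) (hz : ∀ k, (z k).im ≠ 0) {b : ℕ → ℝ}
    (hb : ∀ j, b j ≠ 0) (n : ℕ) :
    convergent φ z b n = toRatFunc (P (n + 1)) / toRatFunc (Q (n + 1)) := by
  obtain ⟨c, hc0, hc, hrec⟩ := h.exists_recurrence hz hb
  rw [convergent, h.tailFraction_eq hc hrec n 0]
  simp [shiftPoly, h.denom_zero, h.num_zero, hc0]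

end IsPadeSystem

section
variable {α β : ℝ} {σ : Measure ℝ} [IsFiniteMeasure σ]

theorem isPadeSystem_markovFunction (hσ : σ (Set.Icc α β)ᶜ = 0) (hsupp : σ.support.Infinite)
    {z : ℕ → ℂ} (hz : ∀ k, (z k).im ≠ 0) {N : ℕ → Finset ℝ} {v : ℕ → ℝ → ℝ}
    (hG : ∀ n, IsGaussRule α β σ (nodePoly z n) n (N n) (v n)) :
    IsPadeSystem α β (markovFunction σ) z (fun n => rootPoly (N n))
      (fun n => gaussNum (nodePoly z n) (N n) (v n))
      (fun n => secondKind σ (nodePoly z n) (N n)) where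
  remainder n lam hl := (hG n).rootPoly_mul_markovFunction hσ (eval_nodePoly_pos hz n)
    (natDegree_nodePoly z n).le hl
  continuousOn n := (differentiableOn_secondKind hσ (eval_nodePoly_pos hz n) _).continuousOn
  remainder_ne_zero n lam hl := (hG n).secondKind_ne_zero hσ hsupp (eval_nodePoly_pos hz n) hl
  remainder_conj n lam := secondKind_conj _ _ _ _
  denom_ne_zero n lam hl := aeval_rootPoly_ne_zero (hG n).mem hl
  monic n := monic_rootPoly _
  natDegree n := by rw [natDegree_rootPoly, (hG n).card]
  degree_lt n := by
    have := degree_gaussNum_lt (nodePoly z n) (N n) (v n)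
    rwa [(hG n).card] at this
  dvd_of_dvd_mul n A h := by
    refine rootPoly_dvd fun x hx => ?_
    have h1 : (A * gaussNum (nodePoly z n) (N n) (v n)).eval x = 0 :=
      eval_eq_zero_of_dvd_of_eval_eq_zero h (eval_rootPoly_eq_zero.mpr hx)
    rw [eval_mul] at h1
    exact (mul_eq_zero.mp h1).resolve_right
      (eval_gaussNum_ne_zero (eval_nodePoly_pos hz n) (hG n).pos hx)

end

/-! ### Multipoint Padé interpolation: multiplicities, existence and uniqueness. -/

theorem toRatFunc_div_denom_dvd (p q : ℝ[X]) :
    (toRatFunc p / toRatFunc q).denom ∣ q.map (algebraMap ℝ ℂ) :=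
  RatFunc.denom_div_dvd _ _

theorem denom_eval_ne_zero {p q : ℝ[X]} {lam : ℂ} (hq : aeval lam q ≠ 0) :
    (toRatFunc p / toRatFunc q).denom.eval lam ≠ 0 := by
  intro h0
  have := eval_eq_zero_of_dvd_of_eval_eq_zero (toRatFunc_div_denom_dvd p q) h0
  rw [eval_map_ofReal] at this
  exact hq this

theorem eval_toRatFunc_div {p q : ℝ[X]} {lam : ℂ} (hq : aeval lam q ≠ 0) :
    (toRatFunc p / toRatFunc q).eval (RingHom.id ℂ) lam = aeval lam p / aeval lam q := by
  have hd := denom_eval_ne_zero (p := p) hq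
  have hq0 : q.map (algebraMap ℝ ℂ) ≠ 0 := by
    intro h0
    rw [← eval_map_ofReal, h0, eval_zero] at hq
    exact hq rfl
  have := RatFunc.num_div_denom (toRatFunc p / toRatFunc q)
  conv_rhs at this => rw [toRatFunc_apply, toRatFunc_apply]
  rw [div_eq_div_iff (RatFunc.algebraMap_ne_zero (RatFunc.denom_ne_zero _))
    (RatFunc.algebraMap_ne_zero hq0), ← map_mul, ← map_mul] at this
  have e := congrArg (Polynomial.eval lam) (RatFunc.algebraMap_injective ℂ this)
  rw [eval_mul, eval_mul, eval_map_ofReal, eval_map_ofReal] at e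
  rw [RatFunc.eval, eval₂_id, eval₂_id, div_eq_div_iff hd hq, e]

theorem eventually_eval_ne_zero {p : ℂ[X]} (hp : p ≠ 0) (x : ℂ) :
    ∀ᶠ w in 𝓝[≠] x, p.eval w ≠ 0 := by
  filter_upwards [(eventually_all_finset p.roots.toFinset).2
    fun r _ => eventually_ne_nhdsNE x r] with w hw h0
  exact hw w (by simpa [hp] using h0) rfl

/-- The punctured neighbourhood is essential: the value of a rational function at a zero of its
denominator is only a default, so identities involving it are known near x and not at x. -/
theorem X_sub_C_pow_dvd_of_eventually {W : ℂ[X]} {x : ℂ} {m : ℕ} {H : ℂ → ℂ}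
    (hH : ContinuousAt H x) (h : ∀ᶠ w in 𝓝[≠] x, W.eval w = (w - x) ^ m * H w) :
    (X - C x) ^ m ∣ W := by
  induction m generalizing H with
  | zero => simp
  | succ m ih =>
    have hc : ContinuousAt (fun w => (w - x) * H w) x := ContinuousAt.mul (by fun_prop) hH
    obtain ⟨V, hV⟩ := ih hc (by
      filter_upwards [h] with w hw
      rw [hw]; ring)
    have hVx : V.eval x = 0 := by
      have h1 := (V.continuous.continuousAt (x := x)).tendsto.mono_left
        (nhdsWithin_le_nhds (s := {x}ᶜ))
      have h2 := hc.tendsto.mono_left (nhdsWithin_le_nhds (s := {x}ᶜ))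
      rw [sub_self, zero_mul] at h2
      refine tendsto_nhds_unique_of_eventuallyEq h1 h2 ?_
      filter_upwards [h, self_mem_nhdsWithin] with w hw hwx
      have h3 : (w - x) ^ m ≠ 0 := pow_ne_zero _ (sub_ne_zero.mpr hwx)
      refine mul_left_cancel₀ h3 ?_
      have h4 : W.eval w = (w - x) ^ m * V.eval w := by rw [hV]; simp
      rw [← h4, hw]
      ring
    obtain ⟨V', hV'⟩ := dvd_iff_isRoot.mpr hVx
    exact ⟨V', by rw [hV, hV']; ring⟩

theorem tendsto_pow_mul_eval_inv {p : ℂ[X]} {d : ℕ} (hp : p.natDegree ≤ d) :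
    Tendsto (fun w : ℂ => w ^ d * p.eval w⁻¹) (𝓝[≠] 0) (𝓝 (p.coeff d)) := by
  have h1 := ((p.reflect d).continuous.continuousAt (x := 0)).tendsto.mono_left
    (nhdsWithin_le_nhds (s := {0}ᶜ))
  rw [← coeff_zero_eq_eval_zero, coeff_reflect, revAt_le (Nat.zero_le d), Nat.sub_zero] at h1
  refine h1.congr' ?_
  filter_upwards [self_mem_nhdsWithin] with w hw
  have hw' : w ≠ 0 := hw
  let _ : Invertible w⁻¹ := invertibleOfNonzero (inv_ne_zero hw')
  have := eval₂_reflect_mul_pow (RingHom.id ℂ) w⁻¹ d p hp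
  rw [eval₂_id, eval₂_id, invOf_eq_inv, inv_inv] at this
  rw [← this, mul_left_comm, ← mul_pow, mul_inv_cancel₀ hw', one_pow, mul_one]

/-- After multiplication by w^d, numerator and denominator at 1/w tend to their coefficients of
degree d. Used for the condition at ∞, where φ vanishes. -/
theorem tendsto_eval_inv_of_tendsto_zero {f : RatFunc ℂ} {d : ℕ} (hn : f.num.natDegree ≤ d)
    (hd : f.denom.natDegree ≤ d)
    (h : Tendsto (fun w : ℂ => f.eval (RingHom.id ℂ) w⁻¹) (𝓝[≠] 0) (𝓝 0)) :
    f.num.coeff d = 0 := by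
  have h1 := tendsto_pow_mul_eval_inv hn
  have h2 := h.mul (tendsto_pow_mul_eval_inv hd)
  rw [zero_mul] at h2
  refine tendsto_nhds_unique_of_eventuallyEq h1 h2 ?_
  have hr : f.denom.reflect d ≠ 0 := by
    rw [Ne, reflect_eq_zero_iff]; exact f.denom_ne_zero
  filter_upwards [self_mem_nhdsWithin, eventually_eval_ne_zero hr 0] with w hw hw2
  have hw' : w ≠ 0 := hw
  let _ : Invertible w⁻¹ := invertibleOfNonzero (inv_ne_zero hw')
  have := eval₂_reflect_mul_pow (RingHom.id ℂ) w⁻¹ d f.denom hd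
  rw [eval₂_id, eval₂_id, invOf_eq_inv, inv_inv] at this
  have h3 : f.denom.eval w⁻¹ ≠ 0 := by
    rw [← this]
    exact mul_ne_zero hw2 (pow_ne_zero _ (inv_ne_zero hw'))
  rw [RatFunc.eval, eval₂_id, eval₂_id, mul_left_comm, div_mul_cancel₀ _ h3]

/-- The finite interpolation nodes `z₀, conj z₀, z₁, conj z₁, …`. -/
def finiteNode (z : ℕ → ℂ) (i : ℕ) : ℂ :=
  if i % 2 = 0 then z (i / 2) else (starRingEnd ℂ) (z (i / 2))

theorem padeNodes_succ (z : ℕ → ℂ) (i : ℕ) :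
    padeNodes z (i + 1) = ((finiteNode z i : ℂ) : OnePoint ℂ) := by
  rw [padeNodes, finiteNode]
  split_ifs <;> rfl

theorem map_nodePoly (z : ℕ → ℂ) (m : ℕ) :
    (nodePoly z m).map (algebraMap ℝ ℂ) =
      (((Multiset.range (2 * m)).map (finiteNode z)).map fun a => X - C a).prod := by
  induction m with
  | zero => simp [nodePoly]
  | succ m ih =>
    have h1 : finiteNode z (2 * m) = z m := by simp [finiteNode]
    have h2 : finiteNode z (2 * m + 1) = (starRingEnd ℂ) (z m) := by
      rw [finiteNode, if_neg (by omega), show (2 * m + 1) / 2 = m by omega]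
    have hq : (nodeQuad (z m)).map (algebraMap ℝ ℂ) =
        (X - C (z m)) * (X - C ((starRingEnd ℂ) (z m))) := by
      refine Polynomial.funext fun lam => ?_
      rw [eval_map_ofReal, aeval_nodeQuad]
      simp
    rw [nodePoly_succ, Polynomial.map_mul, ih, hq, show 2 * (m + 1) = 2 * m + 1 + 1 by ring,
      Multiset.range_succ, Multiset.range_succ]
    simp only [Multiset.map_cons, Multiset.prod_cons, h1, h2]
    ring

/-- Translates repetition among the nodes into root multiplicity; the first of the 2m + 1 places is
taken by ∞. -/
theorem ncard_padeNodes (z : ℕ → ℂ) (m : ℕ) (x : ℂ) :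
    {i : ℕ | i < 2 * m + 1 ∧ padeNodes z i = (x : OnePoint ℂ)}.ncard =
      ((nodePoly z m).map (algebraMap ℝ ℂ)).rootMultiplicity x := by
  classical
  rw [← count_roots, map_nodePoly, roots_multiset_prod_X_sub_C, Multiset.count_map]
  have : {i : ℕ | i < 2 * m + 1 ∧ padeNodes z i = (x : OnePoint ℂ)} =
      (((Finset.range (2 * m)).filter fun i => x = finiteNode z i).map
        ⟨Nat.succ, Nat.succ_injective⟩ : Finset ℕ) := by
    ext i
    cases i with
    | zero => simp [padeNodes]
    | succ i =>
      simp only [Set.mem_ofPred_eq, padeNodes_succ, OnePoint.coe_eq_coe, Finset.coe_map,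
        Function.Embedding.coeFn_mk, Set.mem_image, Finset.mem_coe, Finset.mem_filter,
        Finset.mem_range]
      constructor
      · rintro ⟨h1, h2⟩
        exact ⟨i, ⟨by omega, h2.symm⟩, rfl⟩
      · rintro ⟨k, ⟨h1, h2⟩, h3⟩
        obtain rfl : k = i := by simpa using h3
        exact ⟨by omega, h2.symm⟩
  rw [this, Set.ncard_coe_finset, Finset.card_map]
  rfl

theorem ncard_padeNodes_infty (z : ℕ → ℂ) (m : ℕ) :
    {i : ℕ | i < 2 * m + 1 ∧ padeNodes z i = OnePoint.infty}.ncard = 1 := by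
  rw [Set.ncard_eq_one]
  refine ⟨0, ?_⟩
  ext i
  cases i with
  | zero => simp [padeNodes]
  | succ i => simp [padeNodes_succ]

theorem isMultipointPade_padeNodes_iff (φ : ℂ → ℂ) (z : ℕ → ℂ) (n : ℕ) (f : RatFunc ℂ) :
    IsMultipointPade φ (padeNodes z) (n + 1) (n + 1) f ↔
      f.num.natDegree ≤ n + 1 ∧ f.denom.natDegree ≤ n + 1 ∧
      1 ≤ contactOrder (fun w => f.eval (RingHom.id ℂ) w) φ OnePoint.infty ∧
      ∀ i < 2 * (n + 1),
        ((((nodePoly z (n + 1)).map (algebraMap ℝ ℂ)).rootMultiplicity (finiteNode z i) : ℕ) :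
          ℕ∞) ≤ contactOrder (fun w => f.eval (RingHom.id ℂ) w) φ (finiteNode z i : ℂ) := by
  have e : n + 1 + (n + 1) + 1 = 2 * (n + 1) + 1 := by ring
  rw [IsMultipointPade, e]
  refine and_congr_right fun _ => and_congr_right fun _ => ⟨fun h => ⟨?_, fun i hi => ?_⟩,
    fun h k hk => ?_⟩
  · have := h 0 (by omega)
    rw [show padeNodes z 0 = OnePoint.infty from rfl, ncard_padeNodes_infty] at this
    exact_mod_cast this
  · have := h (i + 1) (by omega)
    rwa [padeNodes_succ, ncard_padeNodes] at this
  · cases k with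
    | zero =>
      rw [show padeNodes z 0 = OnePoint.infty from rfl, ncard_padeNodes_infty]
      exact_mod_cast h.1
    | succ i =>
      rw [padeNodes_succ, ncard_padeNodes]
      exact h.2 i (by omega)

theorem degree_lt_of_coeff_eq_zero {p : ℂ[X]} {d : ℕ} (hp : p.natDegree ≤ d)
    (h : p.coeff d = 0) : p.degree < d := by
  rw [degree_lt_iff_coeff_zero]
  intro m hm
  rcases hm.eq_or_lt with rfl | hlt
  · exact h
  · exact coeff_eq_zero_of_natDegree_lt (hp.trans_lt hlt)

namespace IsPadeSystem
variable {α β : ℝ} {φ : ℂ → ℂ} {z : ℕ → ℂ} {Q P : ℕ → ℝ[X]} {E : ℕ → ℂ → ℂ}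

theorem finiteNode_mem (hz : ∀ k, (z k).im ≠ 0) (i : ℕ) :
    finiteNode z i ∈ (complexInterval α β)ᶜ := by
  apply mem_compl_complexInterval_of_im
  rw [finiteNode]
  split_ifs
  · exact hz _
  · simpa using hz _

theorem isMultipointPade (h : IsPadeSystem α β φ z Q P E) (hz : ∀ k, (z k).im ≠ 0)
    (hE : ∀ n, DifferentiableOn ℂ (E n) (complexInterval α β)ᶜ)
    (hφ : DifferentiableOn ℂ φ (complexInterval α β)ᶜ)
    (hφ0 : Tendsto φ (Bornology.cobounded ℂ) (𝓝 0)) (n : ℕ) :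
    IsMultipointPade φ (padeNodes z) (n + 1) (n + 1)
      (toRatFunc (P (n + 1)) / toRatFunc (Q (n + 1))) := by
  have hU := isOpen_compl_complexInterval (α := α) (β := β)
  have hQ0 : (Q (n + 1)).map (algebraMap ℝ ℂ) ≠ 0 := ((h.monic _).map _).ne_zero
  rw [isMultipointPade_padeNodes_iff]
  refine ⟨?_, ?_, ?_, fun i _ => ?_⟩
  · by_cases hP0 : P (n + 1) = 0
    · simp [hP0]
    refine (natDegree_le_of_dvd (RatFunc.num_div_dvd _ hQ0) ?_).trans ?_
    · exact (Polynomial.map_ne_zero_iff (algebraMap ℝ ℂ).injective).mpr hP0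
    · rw [coe_mapRingHom, natDegree_map]
      exact natDegree_le_of_degree_le (h.degree_lt _).le
  · refine (natDegree_le_of_dvd (RatFunc.denom_div_dvd _ _) hQ0).trans ?_
    rw [natDegree_map, h.natDegree]
  · rw [Order.one_le_iff_ne_zero]
    -- The value at w = 0 is 0 by definition, so only analyticity is left; it follows from the
    -- removable singularity theorem.
    refine analyticOrderAt_ne_zero.mpr ⟨?_, by simp⟩
    have hev : ∀ᶠ w : ℂ in 𝓝[≠] 0, w⁻¹ ∈ (complexInterval α β)ᶜ := by
      refine tendsto_inv₀_nhdsNE_zero.eventually ?_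
      exact Bornology.isBounded_def.mp
        (isCompact_Icc.image Complex.continuous_ofReal).isBounded
    have heq : ∀ w : ℂ, w ≠ 0 → w⁻¹ ∈ (complexInterval α β)ᶜ →
        (if w = 0 then 0 else (toRatFunc (P (n + 1)) / toRatFunc (Q (n + 1))).eval (RingHom.id ℂ)
          w⁻¹ - φ w⁻¹) = aeval w⁻¹ (P (n + 1)) / aeval w⁻¹ (Q (n + 1)) - φ w⁻¹ := by
      intro w hw hwU
      rw [if_neg hw, eval_toRatFunc_div (h.denom_ne_zero _ _ hwU)]
    refine Complex.analyticAt_of_differentiable_on_punctured_nhds_of_continuousAt ?_ ?_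
    · filter_upwards [hev, self_mem_nhdsWithin] with w hwU hw
      have hw' : w ≠ 0 := hw
      have hinv : ContinuousAt (fun w : ℂ => w⁻¹) w := continuousAt_inv₀ hw'
      have hd : DifferentiableAt ℂ
          (fun w : ℂ => aeval w⁻¹ (P (n + 1)) / aeval w⁻¹ (Q (n + 1)) - φ w⁻¹) w := by
        have h1 : DifferentiableAt ℂ (fun w : ℂ => w⁻¹) w := differentiableAt_inv hw'
        have h2 := ((differentiable_aeval_complex (P (n + 1))) w⁻¹).comp w h1
        have h3 := ((differentiable_aeval_complex (Q (n + 1))) w⁻¹).comp w h1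
        have h4 := (hφ.differentiableAt (hU.mem_nhds hwU)).comp w h1
        exact (h2.div h3 (h.denom_ne_zero _ _ hwU)).sub h4
      refine hd.congr_of_eventuallyEq ?_
      filter_upwards [isOpen_ne.mem_nhds hw', hinv.preimage_mem_nhds (hU.mem_nhds hwU)]
        with y hy hyU
      exact heq y hy hyU
    · rw [continuousAt_iff_punctured_nhds]
      simp only [if_true]
      have hP := tendsto_pow_mul_eval_inv (p := (P (n + 1)).map (algebraMap ℝ ℂ)) (d := n + 1)
        (by rw [natDegree_map]; exact natDegree_le_of_degree_le (h.degree_lt _).le)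
      have hQ := tendsto_pow_mul_eval_inv (p := (Q (n + 1)).map (algebraMap ℝ ℂ)) (d := n + 1)
        (by rw [natDegree_map, h.natDegree])
      have hQc : (Q (n + 1)).coeff (n + 1) = 1 := by
        have := h.monic (n + 1)
        rwa [Monic, leadingCoeff, h.natDegree] at this
      have hPc : (P (n + 1)).coeff (n + 1) = 0 := coeff_eq_zero_of_degree_lt (h.degree_lt _)
      rw [coeff_map, hPc, map_zero] at hP
      rw [coeff_map, hQc, map_one] at hQ
      have h1 := (hP.div hQ one_ne_zero).sub (hφ0.comp tendsto_inv₀_nhdsNE_zero)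
      rw [zero_div, sub_zero] at h1
      refine h1.congr' ?_
      filter_upwards [hev, self_mem_nhdsWithin] with w hwU hw
      have hw' : w ≠ 0 := hw
      rw [heq w hw' hwU, Pi.div_apply, Function.comp_apply, eval_map_ofReal, eval_map_ofReal,
        mul_div_mul_left _ _ (pow_ne_zero _ hw')]
  · have hx : finiteNode z i ∈ (complexInterval α β)ᶜ := finiteNode_mem hz i
    set x := finiteNode z i
    set m := ((nodePoly z (n + 1)).map (algebraMap ℝ ℂ)).rootMultiplicity x
    obtain ⟨s, hs⟩ := pow_rootMultiplicity_dvd ((nodePoly z (n + 1)).map (algebraMap ℝ ℂ)) x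
    -- From P/Q - φ = -ω E/Q after the power of w - x has been split off ω.
    let H : ℂ → ℂ := fun w => -(s.eval w * E (n + 1) w / aeval w (Q (n + 1)))
    have hH : AnalyticAt ℂ H x := by
      refine DifferentiableOn.analyticAt (s := (complexInterval α β)ᶜ) ?_ (hU.mem_nhds hx)
      exact ((s.differentiable.differentiableOn.mul (hE _)).div
        (differentiable_aeval_complex _).differentiableOn
        fun w hw => h.denom_ne_zero _ _ hw).neg
    have heq : (fun w => (toRatFunc (P (n + 1)) / toRatFunc (Q (n + 1))).eval (RingHom.id ℂ) w -
        φ w) =ᶠ[𝓝 x] fun w => (w - x) ^ m • H w := by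
      filter_upwards [hU.mem_nhds hx] with w hw
      have hq := h.denom_ne_zero (n + 1) w hw
      have h1 := h.remainder (n + 1) w hw
      have h2 : aeval w (nodePoly z (n + 1)) = (w - x) ^ m * s.eval w := by
        rw [← eval_map_ofReal, hs]; simp [m]
      rw [eval_toRatFunc_div hq]
      simp only [H, smul_eq_mul]
      rw [h2] at h1
      field_simp
      linear_combination -h1
    change (m : ℕ∞) ≤ analyticOrderAt _ x
    rw [analyticOrderAt_congr heq, natCast_le_analyticOrderAt]
    · exact ⟨H, hH, Eventually.of_forall fun w => rfl⟩
    · exact AnalyticAt.smul (f := fun w => (w - x) ^ m) (by fun_prop) hH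

/-- The condition at ∞ lowers the degree of the numerator of f by one. The cross product W then has
degree below 2(n + 1) but is divisible by the node polynomial of that degree. -/
theorem eq_of_isMultipointPade (h : IsPadeSystem α β φ z Q P E) (hz : ∀ k, (z k).im ≠ 0)
    (hφ0 : Tendsto φ (Bornology.cobounded ℂ) (𝓝 0)) (n : ℕ) {f : RatFunc ℂ}
    (hf : IsMultipointPade φ (padeNodes z) (n + 1) (n + 1) f) :
    f = toRatFunc (P (n + 1)) / toRatFunc (Q (n + 1)) := by
  classical
  have hU := isOpen_compl_complexInterval (α := α) (β := β)
  rw [isMultipointPade_padeNodes_iff] at hf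
  obtain ⟨hn, hd, hinf, hfin⟩ := hf
  have hnum : f.num.degree < (n + 1 : ℕ) := by
    refine degree_lt_of_coeff_eq_zero hn (tendsto_eval_inv_of_tendsto_zero hn hd ?_)
    rw [Order.one_le_iff_ne_zero] at hinf
    obtain ⟨han, -⟩ := analyticOrderAt_ne_zero.mp hinf
    have h1 := han.continuousAt.tendsto.mono_left (nhdsWithin_le_nhds (s := {0}ᶜ))
    rw [if_pos rfl] at h1
    have h2 := h1.add (hφ0.comp tendsto_inv₀_nhdsNE_zero)
    rw [add_zero] at h2
    refine h2.congr' ?_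
    filter_upwards [self_mem_nhdsWithin] with w hw
    have hw' : w ≠ 0 := hw
    simp [hw']
  set Qc := (Q (n + 1)).map (algebraMap ℝ ℂ) with hQc
  set Pc := (P (n + 1)).map (algebraMap ℝ ℂ) with hPc
  have hQ0 : Qc ≠ 0 := ((h.monic _).map _).ne_zero
  set W : ℂ[X] := f.num * Qc - Pc * f.denom with hW
  have hWdeg : W.degree < (2 * (n + 1) : ℕ) := by
    have h1 := degree_mul_lt_of_le_of_lt (p := Qc) (m := n + 1)
      (by rw [hQc, degree_map, h.degree_denom]) hnum
    have h2 := degree_mul_lt_of_le_of_lt (p := f.denom) (m := n + 1) (q := Pc) (n := n + 1)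
      (degree_le_of_natDegree_le hd) (by rw [hPc, degree_map]; exact h.degree_lt _)
    rw [mul_comm] at h1 h2
    rw [two_mul]
    exact (degree_sub_le _ _).trans_lt (max_lt h1 h2)
  have hmult : ∀ i < 2 * (n + 1),
      (X - C (finiteNode z i)) ^
        ((nodePoly z (n + 1)).map (algebraMap ℝ ℂ)).rootMultiplicity (finiteNode z i) ∣ W := by
    intro i hi
    have hx : finiteNode z i ∈ (complexInterval α β)ᶜ := finiteNode_mem hz i
    have hord := hfin i hi
    set x := finiteNode z i
    set m := ((nodePoly z (n + 1)).map (algebraMap ℝ ℂ)).rootMultiplicity x with hm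
    -- A positive multiplicity is what makes the difference analytic: the order of a function that
    -- is not analytic defaults to 0.
    have hm0 : m ≠ 0 := by
      rw [hm, ← count_roots, map_nodePoly, roots_multiset_prod_X_sub_C]
      exact Multiset.count_ne_zero.mpr
        (Multiset.mem_map_of_mem _ (Multiset.mem_range.mpr hi))
    change (m : ℕ∞) ≤ analyticOrderAt _ x at hord
    have han : AnalyticAt ℂ (fun w => f.eval (RingHom.id ℂ) w - φ w) x := by
      refine (analyticOrderAt_ne_zero.mp ?_).1
      intro h0
      rw [h0] at hord
      exact hm0 (by exact_mod_cast (le_antisymm hord bot_le))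
    obtain ⟨g, hg, hgeq⟩ := (natCast_le_analyticOrderAt han).mp hord
    obtain ⟨s, hs⟩ := pow_rootMultiplicity_dvd ((nodePoly z (n + 1)).map (algebraMap ℝ ℂ)) x
    have hcE := (h.continuousOn (n + 1)).continuousAt (hU.mem_nhds hx)
    refine X_sub_C_pow_dvd_of_eventually (H := fun w => f.denom.eval w *
      (Qc.eval w * g w + s.eval w * E (n + 1) w)) ?_ ?_
    · exact f.denom.continuous.continuousAt.mul ((Qc.continuous.continuousAt.mul
        hg.continuousAt).add (s.continuous.continuousAt.mul hcE))
    · filter_upwards [nhdsWithin_le_nhds hgeq, nhdsWithin_le_nhds (hU.mem_nhds hx),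
        eventually_eval_ne_zero f.denom_ne_zero x] with w h1 hw h2
      have h3 := h.remainder (n + 1) w hw
      have h4 : aeval w (nodePoly z (n + 1)) = (w - x) ^ m * s.eval w := by
        rw [← eval_map_ofReal, hs]; simp [m]
      rw [h4, ← eval_map_ofReal, ← eval_map_ofReal] at h3
      rw [RatFunc.eval, eval₂_id, eval₂_id, smul_eq_mul] at h1
      have h5 : f.num.eval w = f.denom.eval w * ((w - x) ^ m * g w + φ w) := by
        rw [← h1]; field_simp; ring
      rw [hW, eval_sub, eval_mul, eval_mul, h5]
      linear_combination f.denom.eval w * h3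
  have hW0 : W = 0 := by
    by_contra hne
    have hdvd : (nodePoly z (n + 1)).map (algebraMap ℝ ℂ) ∣ W := by
      rw [map_nodePoly, Multiset.prod_X_sub_C_dvd_iff_le_roots hne, Multiset.le_iff_count]
      intro x
      by_cases hx : x ∈ (Multiset.range (2 * (n + 1))).map (finiteNode z)
      · obtain ⟨i, hi, rfl⟩ := Multiset.mem_map.mp hx
        have := hmult i (Multiset.mem_range.mp hi)
        rw [← le_rootMultiplicity_iff hne, ← count_roots, ← count_roots, map_nodePoly,
          roots_multiset_prod_X_sub_C] at this
        exact this
      · rw [Multiset.count_eq_zero_of_notMem hx]; exact Nat.zero_le _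
    have := natDegree_le_of_dvd hdvd hne
    rw [natDegree_map, natDegree_nodePoly] at this
    rw [degree_eq_natDegree hne] at hWdeg
    norm_cast at hWdeg
    omega
  conv_lhs => rw [← f.num_div_denom]
  rw [toRatFunc_apply, toRatFunc_apply, div_eq_div_iff
    (RatFunc.algebraMap_ne_zero f.denom_ne_zero) (RatFunc.algebraMap_ne_zero hQ0),
    ← map_mul, ← map_mul, sub_eq_zero.mp hW0]

end IsPadeSystem

theorem tendsto_markovFunction_cobounded {α β : ℝ} {σ : Measure ℝ} [IsFiniteMeasure σ]
    (hσ : σ (Set.Icc α β)ᶜ = 0) :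
    Tendsto (markovFunction σ) (Bornology.cobounded ℂ) (𝓝 0) := by
  obtain ⟨B, hB⟩ := (isCompact_Icc (a := α) (b := β)).isBounded.exists_norm_le
  have h1 : Tendsto (fun lam : ℂ => (‖lam‖ - B)⁻¹ * σ.real univ) (Bornology.cobounded ℂ) (𝓝 0) := by
    have : Tendsto (fun lam : ℂ => ‖lam‖ - B) (Bornology.cobounded ℂ) atTop :=
      tendsto_atTop_add_const_right _ _ tendsto_norm_cobounded_atTop
    simpa using (tendsto_inv_atTop_zero.comp this).mul_const (σ.real univ)
  refine squeeze_zero_norm' ?_ h1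
  have : ∀ᶠ lam : ℂ in Bornology.cobounded ℂ, B < ‖lam‖ :=
    tendsto_norm_cobounded_atTop.eventually_gt_atTop B
  filter_upwards [this] with lam hlam
  refine norm_integral_le_of_norm_le_const ?_
  filter_upwards [ae_mem_Icc hσ] with t ht
  rw [norm_inv]
  refine inv_anti₀ (by linarith) ?_
  have h2 := hB t ht
  have h3 := norm_sub_norm_le lam (t : ℂ)
  rw [norm_sub_rev, Complex.norm_real] at h3
  linarith

/-! ### Circles, reflections and a separating disc. -/

section Geometry

/-- Compares the reflected factor with ρ|s - s'|: which is larger depends on whether s and s' lie on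
the same side of the circle of radius ρ. -/
theorem norm_mul_conj_sub_sq (s s' : ℂ) (ρ : ℝ) :
    ‖s * (starRingEnd ℂ) s' - (ρ : ℂ) ^ 2‖ ^ 2 =
      ρ ^ 2 * ‖s - s'‖ ^ 2 + (‖s‖ ^ 2 - ρ ^ 2) * (‖s'‖ ^ 2 - ρ ^ 2) := by
  rw [← Complex.ofReal_pow]
  simp only [Complex.sq_norm, Complex.normSq_apply, Complex.sub_re, Complex.sub_im, Complex.mul_re,
    Complex.mul_im, Complex.conj_re, Complex.conj_im, Complex.ofReal_re, Complex.ofReal_im]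
  ring

theorem mul_norm_sub_le {s s' : ℂ} {ρ : ℝ} (hρ : 0 ≤ ρ) (hs : ρ ≤ ‖s‖) (hs' : ρ ≤ ‖s'‖) :
    ρ * ‖s - s'‖ ≤ ‖s * (starRingEnd ℂ) s' - (ρ : ℂ) ^ 2‖ := by
  refine le_of_sq_le_sq ?_ (norm_nonneg _)
  rw [norm_mul_conj_sub_sq, mul_pow]
  have h1 : 0 ≤ ‖s‖ ^ 2 - ρ ^ 2 := by nlinarith
  have h2 : 0 ≤ ‖s'‖ ^ 2 - ρ ^ 2 := by nlinarith
  nlinarith [mul_nonneg h1 h2]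

theorem exists_blaschke_ratio {ρ₁ ρ ρ₂ : ℝ} (h0 : 0 ≤ ρ₁) (h1 : ρ₁ < ρ) (h2 : ρ < ρ₂) :
    ∃ q : ℝ, 0 ≤ q ∧ q < 1 ∧ ∀ s s' : ℂ, ‖s‖ ≤ ρ₁ → ρ₂ ≤ ‖s'‖ →
      ‖s * (starRingEnd ℂ) s' - (ρ : ℂ) ^ 2‖ ≤ q * (ρ * ‖s - s'‖) := by
  have hρ : 0 < ρ := h0.trans_lt h1
  set κ := (ρ ^ 2 - ρ₁ ^ 2) / ρ ^ 2 with hκ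
  set η := (ρ₂ - ρ) / (ρ₂ + ρ) with hη
  have hκ0 : 0 < κ := div_pos (by nlinarith) (by positivity)
  have hκ1 : κ ≤ 1 := by rw [hκ, div_le_one (by positivity)]; nlinarith
  have hη0 : 0 < η := div_pos (by linarith) (by linarith)
  have hη1 : η ≤ 1 := by rw [hη, div_le_one (by linarith)]; linarith
  have hκη : κ * η ≤ 1 := by nlinarith
  -- κ bounds 1 - |s|²/ρ² from below, and η bounds (|s'|² - ρ²)/|s - s'|² from below, uniformly for
  -- unbounded s' because |s - s'| ≤ ρ + |s'|.
  refine ⟨√(1 - κ * η), Real.sqrt_nonneg _, ?_, fun s s' hs hs' => ?_⟩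
  · rw [Real.sqrt_lt' one_pos]
    have := mul_pos hκ0 hη0
    linarith
  · refine le_of_sq_le_sq ?_ (by positivity)
    rw [norm_mul_conj_sub_sq, mul_pow, mul_pow, Real.sq_sqrt (by linarith)]
    set u := ‖s'‖
    have hn : ‖s - s'‖ ≤ ρ + u := (norm_sub_le s s').trans (by gcongr; linarith)
    have hn2 : ‖s - s'‖ ^ 2 ≤ (ρ + u) ^ 2 := by gcongr
    have hu : η * (u + ρ) ≤ u - ρ := by
      rw [hη, div_mul_eq_mul_div, div_le_iff₀ (by linarith)]
      nlinarith
    have e1 : κ * ρ ^ 2 = ρ ^ 2 - ρ₁ ^ 2 := by rw [hκ]; field_simp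
    have e2 : κ * ρ ^ 2 ≤ ρ ^ 2 - ‖s‖ ^ 2 := by
      rw [e1]
      have := norm_nonneg s
      nlinarith
    have e3 : η * ‖s - s'‖ ^ 2 ≤ u ^ 2 - ρ ^ 2 := by
      calc η * ‖s - s'‖ ^ 2 ≤ η * (ρ + u) ^ 2 := by gcongr
        _ = η * (u + ρ) * (u + ρ) := by ring
        _ ≤ (u - ρ) * (u + ρ) := by
          have : 0 ≤ u + ρ := by linarith
          gcongr
        _ = u ^ 2 - ρ ^ 2 := by ring
    have e4 : (κ * ρ ^ 2) * (η * ‖s - s'‖ ^ 2) ≤ (ρ ^ 2 - ‖s‖ ^ 2) * (u ^ 2 - ρ ^ 2) :=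
      mul_le_mul e2 e3 (by positivity) ((by positivity : 0 ≤ κ * ρ ^ 2).trans e2)
    nlinarith

/-- A disc that contains `[α, β]` and leaves outside a given point of the closed upper half plane
and the half plane `Im > δ`. -/
theorem exists_separating_disc {α β δ : ℝ} (hαβ : α ≤ β) (hδ : 0 < δ) {lam : ℂ}
    (hlam : lam ∈ (complexInterval α β)ᶜ) (him : 0 ≤ lam.im) :
    ∃ (a : ℂ) (ρ₁ ρ ρ₂ : ℝ), 0 ≤ ρ₁ ∧ ρ₁ < ρ ∧ ρ < ρ₂ ∧
      (∀ t ∈ Set.Icc α β, ‖(t : ℂ) - a‖ ≤ ρ₁) ∧ ρ ≤ ‖lam - a‖ ∧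
      ∀ w : ℂ, δ < w.im → ρ₂ ≤ ‖w - a‖ := by
  set c := (α + β) / 2 with hc
  set r := (β - α) / 2 with hr
  have hr0 : 0 ≤ r := by rw [hr]; linarith
  -- The disc has centre c - iT and its circle passes through α and β. For large T its part in the
  -- upper half plane is a thin cap over [α, β], below height δ and away from lam. For real lam off
  -- the interval the last condition holds for every T.
  obtain ⟨T, hT0, hTδ, hTl⟩ : ∃ T : ℝ, 0 < T ∧ r ^ 2 < 2 * δ * T ∧
      r ^ 2 + T ^ 2 < (lam.re - c) ^ 2 + (lam.im + T) ^ 2 := by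
    rcases him.eq_or_lt with h | h
    · refine ⟨(r ^ 2 + 1) / (2 * δ), by positivity, ?_, ?_⟩
      · rw [mul_div_cancel₀ _ (by positivity)]; linarith
      · rw [← h]
        have h1 : r ^ 2 < (lam.re - c) ^ 2 := by
          by_contra hle
          have h2 := abs_le_of_sq_le_sq' (not_lt.mp hle) hr0
          refine hlam ⟨lam.re, ⟨?_, ?_⟩, Complex.ext (by simp) (by simp [← h])⟩
          · rw [hr, hc] at h2; linarith [h2.1]
          · rw [hr, hc] at h2; linarith [h2.2]
        nlinarith
    · set μ := min δ lam.im with hμ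
      have hμ0 : 0 < μ := lt_min hδ h
      have e : 2 * μ * ((r ^ 2 + 1) / (2 * μ)) = r ^ 2 + 1 := mul_div_cancel₀ _ (by positivity)
      have hT0 : 0 < (r ^ 2 + 1) / (2 * μ) := by positivity
      refine ⟨(r ^ 2 + 1) / (2 * μ), hT0, ?_, ?_⟩
      · have := mul_le_mul_of_nonneg_right (min_le_left δ lam.im) hT0.le
        linarith
      · have := mul_le_mul_of_nonneg_right (min_le_right δ lam.im) hT0.le
        nlinarith [sq_nonneg (lam.re - c), sq_nonneg lam.im]
  let a : ℂ := ⟨c, -T⟩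
  have hnorm : ∀ w : ℂ, ‖w - a‖ ^ 2 = (w.re - c) ^ 2 + (w.im + T) ^ 2 := by
    intro w
    rw [Complex.sq_norm, Complex.normSq_apply]
    simp [a]
    ring
  have h1 : √(r ^ 2 + T ^ 2) < δ + T := by
    rw [Real.sqrt_lt' (by positivity)]; nlinarith
  have h2 : √(r ^ 2 + T ^ 2) < ‖lam - a‖ := by
    rw [Real.sqrt_lt (by positivity) (norm_nonneg _), hnorm]; exact hTl
  have h3 := lt_min h2 h1
  refine ⟨a, √(r ^ 2 + T ^ 2), (√(r ^ 2 + T ^ 2) + min ‖lam - a‖ (δ + T)) / 2, δ + T,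
    Real.sqrt_nonneg _, by linarith, ?_, ?_, ?_, ?_⟩
  · have := min_le_right ‖lam - a‖ (δ + T)
    linarith
  · intro t ht
    refine Real.le_sqrt_of_sq_le ?_
    rw [hnorm]
    have h4 : (t - c) ^ 2 ≤ r ^ 2 := by
      apply sq_le_sq'
      · rw [hr, hc]; linarith [ht.1]
      · rw [hr, hc]; linarith [ht.2]
    simpa using h4
  · have := min_le_left ‖lam - a‖ (δ + T)
    linarith
  · intro w hw
    refine le_of_sq_le_sq ?_ (norm_nonneg _)
    rw [hnorm]
    nlinarith [sq_nonneg (w.re - c)]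

end Geometry

/-! ### Convergence of the quadrature transforms. -/

section Convergence

/-- The node polynomial has degree 2(n + 1), just too large for exactness. Without the factor of z_0
the rule is exact and returns the integral of 1/`nodeQuad (z 0)`, which is independent of n; the
omitted factor is bounded on [α, β]. -/
theorem exists_gauss_mass_bound (α β : ℝ) (σ : Measure ℝ) {z : ℕ → ℂ}
    (hz : ∀ k, (z k).im ≠ 0) :
    ∃ M : ℝ, 0 ≤ M ∧ ∀ (n : ℕ) (N : Finset ℝ) (v : ℝ → ℝ),
      IsGaussRule α β σ (nodePoly z (n + 1)) (n + 1) N v →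
        ∑ x ∈ N, v x * (nodePoly z (n + 1)).eval x ≤ M := by
  obtain ⟨D, hD⟩ := isCompact_Icc.exists_bound_of_continuousOn
    ((nodeQuad (z 0)).continuous.continuousOn (s := Set.Icc α β))
  set I := ∫ t, ((nodeQuad (z 0)).eval t)⁻¹ ∂σ with hI
  have hI0 : 0 ≤ I := integral_nonneg fun t => (inv_pos.mpr (eval_nodeQuad_pos (hz 0) t)).le
  refine ⟨|D| * I, by positivity, fun n N v h => ?_⟩
  set p := nodePoly (fun k => z (k + 1)) n with hp
  have hfac : nodePoly z (n + 1) = p * nodeQuad (z 0) := Finset.prod_range_succ' _ _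
  have hp0 := eval_nodePoly_pos (fun k => hz (k + 1)) n
  have hdeg : (p.map (algebraMap ℝ ℂ)).degree < (2 * (n + 1) : ℕ) := by
    refine degree_le_natDegree.trans_lt ?_
    rw [natDegree_map, hp, natDegree_nodePoly]
    exact_mod_cast (by omega : 2 * n < 2 * (n + 1))
  have hex := h.exact _ hdeg
  have hsum : ∑ x ∈ N, v x * p.eval x = I := by
    have h1 : ((I : ℝ) : ℂ) = ((∑ x ∈ N, v x * p.eval x : ℝ) : ℂ) := by
      rw [hI, ← integral_complex_ofReal]
      push_cast
      simp only [eval_map_ofReal, aeval_ofReal_eq] at hex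
      rw [← hex]
      refine integral_congr_ae (Eventually.of_forall fun t => ?_)
      have h2 : ((p.eval t : ℝ) : ℂ) ≠ 0 := by exact_mod_cast (hp0 t).ne'
      have h3 : (((nodeQuad (z 0)).eval t : ℝ) : ℂ) ≠ 0 := by
        exact_mod_cast (eval_nodeQuad_pos (hz 0) t).ne'
      simp only [hfac, eval_mul]
      push_cast
      field_simp
    exact_mod_cast h1.symm
  rw [← hsum, Finset.mul_sum]
  refine Finset.sum_le_sum fun x hx => ?_
  rw [hfac, eval_mul]
  have h1 : (nodeQuad (z 0)).eval x ≤ |D| :=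
    (le_abs_self _).trans ((hD x (h.mem x hx)).trans (le_abs_self D))
  have h2 := mul_pos (h.pos x hx) (hp0 x)
  calc v x * (p.eval x * (nodeQuad (z 0)).eval x)
      = (v x * p.eval x) * (nodeQuad (z 0)).eval x := by ring
    _ ≤ (v x * p.eval x) * |D| := mul_le_mul_of_nonneg_left h1 h2.le
    _ = _ := by ring

variable {α β : ℝ} {σ : Measure ℝ} [IsFiniteMeasure σ]

/-- The Cauchy transform of the quadrature measure, which is the Padé approximant. -/
def quadTransform (ω : ℝ[X]) (N : Finset ℝ) (v : ℝ → ℝ) (lam : ℂ) : ℂ :=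
  ∑ x ∈ N, ((v x * ω.eval x : ℝ) : ℂ) * ((x : ℂ) - lam)⁻¹

theorem quadTransform_conj (ω : ℝ[X]) (N : Finset ℝ) (v : ℝ → ℝ) (lam : ℂ) :
    quadTransform ω N v ((starRingEnd ℂ) lam) = (starRingEnd ℂ) (quadTransform ω N v lam) := by
  simp [quadTransform]

namespace IsGaussRule
variable {ω : ℝ[X]} {n : ℕ} {N : Finset ℝ} {v : ℝ → ℝ}

/-- Both measures give the same integral of p/ω, so only f - p/ω contributes, with at most the two
total masses as factors. -/
theorem norm_integral_sub_sum_le (h : IsGaussRule α β σ ω n N v) (hσ : σ (Set.Icc α β)ᶜ = 0)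
    (hω : ∀ t, 0 < ω.eval t) {f : ℝ → ℂ} (hf : ContinuousOn f (Set.Icc α β)) {p : ℂ[X]}
    (hp : p.degree < (2 * n : ℕ)) {ε : ℝ}
    (hε : ∀ t ∈ Set.Icc α β, ‖f t - (((ω.eval t)⁻¹ : ℝ) : ℂ) * p.eval (t : ℂ)‖ ≤ ε) :
    ‖∫ t, f t ∂σ - ∑ x ∈ N, ((v x * ω.eval x : ℝ) : ℂ) * f x‖ ≤
      ε * (σ.real univ + ∑ x ∈ N, v x * ω.eval x) := by
  have hg : ContinuousOn (fun t : ℝ => (((ω.eval t)⁻¹ : ℝ) : ℂ) * p.eval (t : ℂ))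
      (Set.Icc α β) :=
    (Complex.continuous_ofReal.comp_continuousOn (continuousOn_inv_eval hω _)).mul (by fun_prop)
  have hsum : ∑ x ∈ N, (v x : ℂ) * p.eval (x : ℂ) =
      ∑ x ∈ N, ((v x * ω.eval x : ℝ) : ℂ) * ((((ω.eval x)⁻¹ : ℝ) : ℂ) * p.eval (x : ℂ)) := by
    refine Finset.sum_congr rfl fun x _ => ?_
    have : ((ω.eval x : ℝ) : ℂ) ≠ 0 := by exact_mod_cast (hω x).ne'
    push_cast
    field_simp
  have key : ∫ t, f t ∂σ - ∑ x ∈ N, ((v x * ω.eval x : ℝ) : ℂ) * f x =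
      ∫ t, (f t - (((ω.eval t)⁻¹ : ℝ) : ℂ) * p.eval (t : ℂ)) ∂σ -
      ∑ x ∈ N, ((v x * ω.eval x : ℝ) : ℂ) *
        (f x - (((ω.eval x)⁻¹ : ℝ) : ℂ) * p.eval (x : ℂ)) := by
    rw [integral_sub (integrable_of_continuousOn_Icc hσ hf) (integrable_of_continuousOn_Icc hσ hg),
      h.exact p hp, hsum]
    simp only [mul_sub, Finset.sum_sub_distrib]
    ring
  rw [key, mul_add]
  refine (norm_sub_le _ _).trans (add_le_add ?_ ?_)
  · refine norm_integral_le_of_norm_le_const ?_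
    filter_upwards [ae_mem_Icc hσ] with t ht using hε t ht
  · rw [Finset.mul_sum]
    refine (norm_sum_le _ _).trans (Finset.sum_le_sum fun x hx => ?_)
    have hpos := mul_pos (h.pos x hx) (hω x)
    rw [norm_mul, Complex.norm_real, Real.norm_of_nonneg hpos.le, mul_comm]
    exact mul_le_mul_of_nonneg_right (hε x (h.mem x hx)) hpos.le

end IsGaussRule

/-- Choose p so that 1/(t - lam) - p/ω = ω(lam) B(t) / (B(lam) ω(t) (t - lam)), where B is the
product of the l_k(t)(t - conj z_k). The conjugate factors cancel, and each remaining quotient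
contributes a factor q. -/
theorem norm_markovFunction_sub_quadTransform_le (hσ : σ (Set.Icc α β)ᶜ = 0) {z : ℕ → ℂ}
    (hz : ∀ k, 0 < (z k).im) {n : ℕ} {N : Finset ℝ} {v : ℝ → ℝ}
    (h : IsGaussRule α β σ (nodePoly z n) n N v) {lam : ℂ}
    (hlam : lam ∈ (complexInterval α β)ᶜ) (him : 0 ≤ lam.im) {d q : ℝ} (hd : 0 < d) (hq : 0 ≤ q)
    (hdist : ∀ t ∈ Set.Icc α β, d ≤ ‖(t : ℂ) - lam‖) (l : ℕ → ℂ[X])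
    (hl : ∀ k, (l k).natDegree ≤ 1) (hl0 : ∀ k, (l k).eval lam ≠ 0)
    (hlq : ∀ k, ∀ t ∈ Set.Icc α β,
      ‖lam - z k‖ * ‖(l k).eval (t : ℂ)‖ ≤ q * (‖(l k).eval lam‖ * ‖(t : ℂ) - z k‖)) :
    ‖markovFunction σ lam - quadTransform (nodePoly z n) N v lam‖ ≤
      q ^ n / d * (σ.real univ + ∑ x ∈ N, v x * (nodePoly z n).eval x) := by
  have hω := eval_nodePoly_pos (fun k => (hz k).ne') n
  let B : ℂ[X] := ∏ k ∈ Finset.range n, (l k * (X - C ((starRingEnd ℂ) (z k))))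
  have hBdeg : B.natDegree ≤ 2 * n := by
    refine (natDegree_prod_le _ _).trans ?_
    have hk : ∀ k ∈ Finset.range n, (l k * (X - C ((starRingEnd ℂ) (z k)))).natDegree ≤ 2 := by
      intro k _
      refine natDegree_mul_le.trans ?_
      have := hl k
      rw [natDegree_X_sub_C]
      omega
    refine (Finset.sum_le_sum hk).trans ?_
    simp [mul_comm]
  have hB0 : B.eval lam ≠ 0 := by
    simp only [B, eval_prod, eval_mul, Finset.prod_ne_zero_iff]
    intro k _
    refine mul_ne_zero (hl0 k) ?_
    intro h0
    have := congrArg Complex.im h0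
    simp at this
    linarith [hz k]
  have hbound : ∀ t ∈ Set.Icc α β, ‖aeval lam (nodePoly z n)‖ * ‖B.eval (t : ℂ)‖ ≤
      q ^ n * (‖B.eval lam‖ * ‖aeval (t : ℂ) (nodePoly z n)‖) := by
    intro t ht
    have hcard : q ^ n = ∏ _k ∈ Finset.range n, q := by simp
    simp only [B, eval_prod, nodePoly, map_prod, norm_prod, hcard, ← Finset.prod_mul_distrib]
    refine Finset.prod_le_prod (fun k _ => by positivity) fun k _ => ?_
    have h1 := mul_le_mul_of_nonneg_right (hlq k t ht) (mul_nonneg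
      (norm_nonneg (lam - (starRingEnd ℂ) (z k))) (norm_nonneg ((t : ℂ) - (starRingEnd ℂ) (z k))))
    simp only [aeval_nodeQuad, eval_mul, eval_sub, eval_X, eval_C, norm_mul]
    linarith
  let p : ℂ[X] := C (B.eval lam) * (nodePoly z n).map (algebraMap ℝ ℂ) -
    C (aeval lam (nodePoly z n)) * B
  have hpd : p.natDegree ≤ 2 * n := by
    refine (natDegree_sub_le _ _).trans (max_le ?_ ?_)
    · exact (natDegree_C_mul_le _ _).trans (natDegree_map_le.trans (natDegree_nodePoly z n).le)
    · exact (natDegree_C_mul_le _ _).trans hBdeg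
  have hp0 : p.eval lam = 0 := by
    simp only [p, eval_sub, eval_mul, eval_C, eval_map_ofReal]
    ring
  obtain ⟨e, he, hed⟩ := exists_divided_difference hpd hp0
  have hed' : (C (B.eval lam)⁻¹ * e).degree < (2 * n : ℕ) := by
    rw [← smul_eq_C_mul]
    exact (degree_smul_le _ _).trans_lt hed
  refine h.norm_integral_sub_sum_le hσ hω (continuousOn_inv_ofReal_sub hlam) hed' ?_
  intro t ht
  have h1 := ofReal_sub_ne_zero hlam ht
  have hωt : (((nodePoly z n).eval t : ℝ) : ℂ) ≠ 0 := by exact_mod_cast (hω t).ne'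
  have h2 : p.eval (t : ℂ) = ((t : ℂ) - lam) * e.eval (t : ℂ) := by rw [he]; simp
  simp only [p, eval_sub, eval_mul, eval_C, eval_map_ofReal, aeval_ofReal_eq] at h2
  have h3 : ((t : ℂ) - lam)⁻¹ - (((((nodePoly z n).eval t)⁻¹ : ℝ) : ℂ) *
      (C (B.eval lam)⁻¹ * e).eval (t : ℂ)) =
      aeval lam (nodePoly z n) * B.eval (t : ℂ) /
        ((B.eval lam * aeval (t : ℂ) (nodePoly z n)) * ((t : ℂ) - lam)) := by
    rw [eval_mul, eval_C, aeval_ofReal_eq]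
    push_cast
    field_simp
    linear_combination h2
  rw [h3, norm_div, norm_mul, norm_mul, norm_mul]
  have hpos : 0 < ‖B.eval lam‖ * ‖aeval (t : ℂ) (nodePoly z n)‖ := by
    rw [aeval_ofReal_eq]
    exact mul_pos (norm_pos_iff.mpr hB0) (norm_pos_iff.mpr hωt)
  rw [div_le_div_iff₀ (mul_pos hpos (norm_pos_iff.mpr h1)) hd]
  calc ‖aeval lam (nodePoly z n)‖ * ‖B.eval (t : ℂ)‖ * d
      ≤ q ^ n * (‖B.eval lam‖ * ‖aeval (t : ℂ) (nodePoly z n)‖) * ‖(t : ℂ) - lam‖ :=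
        mul_le_mul (hbound t ht) (hdist t ht) hd.le (by positivity)
    _ = _ := by ring

theorem tendsto_quadTransform_of_im_nonneg (hσ : σ (Set.Icc α β)ᶜ = 0) (hαβ : α ≤ β) {z : ℕ → ℂ}
    {δ : ℝ} (hδ : 0 < δ) (hz : ∀ k, δ < (z k).im) {N : ℕ → Finset ℝ} {v : ℕ → ℝ → ℝ}
    (hG : ∀ n, IsGaussRule α β σ (nodePoly z n) n (N n) (v n)) {lam : ℂ}
    (hlam : lam ∈ (complexInterval α β)ᶜ) (him : 0 ≤ lam.im) :
    Tendsto (fun n => quadTransform (nodePoly z (n + 1)) (N (n + 1)) (v (n + 1)) lam) atTop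
      (𝓝 (markovFunction σ lam)) := by
  have hz0 : ∀ k, 0 < (z k).im := fun k => hδ.trans (hz k)
  obtain ⟨M, hM0, hM⟩ := exists_gauss_mass_bound α β σ (fun k => (hz0 k).ne')
  obtain ⟨d, hd, hdist⟩ := exists_dist_le hlam
  obtain ⟨a, ρ₁, ρ, ρ₂, h0, h1, h2, hI, hla, hzρ⟩ := exists_separating_disc hαβ hδ hlam him
  obtain ⟨q, hq0, hq1, hq⟩ := exists_blaschke_ratio h0 h1 h2
  have hρ : 0 < ρ := h0.trans_lt h1
  -- The zero of l_k is the reflection of z_k in the circle |w - a| = ρ. Thus |l_k(w)| is at least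
  -- ρ|w - z_k| at lam, outside the circle, and at most qρ|w - z_k| on [α, β].
  let l : ℕ → ℂ[X] := fun k =>
    C ((starRingEnd ℂ) (z k - a)) * (X - C a) - C ((ρ : ℂ) ^ 2)
  have hleval : ∀ k w, (l k).eval w = (w - a) * (starRingEnd ℂ) (z k - a) - (ρ : ℂ) ^ 2 := by
    intro k w
    simp only [l, eval_sub, eval_mul, eval_C, eval_X]
    ring
  have hl : ∀ k, (l k).natDegree ≤ 1 := by
    intro k
    refine natDegree_sub_C.trans_le ((natDegree_C_mul_le _ _).trans ?_)
    rw [natDegree_X_sub_C]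
  have hl0 : ∀ k, (l k).eval lam ≠ 0 := by
    intro k h0'
    rw [hleval, sub_eq_zero] at h0'
    have e := congrArg norm h0'
    rw [norm_mul, RCLike.norm_conj, norm_pow, Complex.norm_real, Real.norm_of_nonneg hρ.le] at e
    have h3 := hzρ _ (hz k)
    nlinarith [norm_nonneg (lam - a)]
  have hlq : ∀ k, ∀ t ∈ Set.Icc α β,
      ‖lam - z k‖ * ‖(l k).eval (t : ℂ)‖ ≤ q * (‖(l k).eval lam‖ * ‖(t : ℂ) - z k‖) := by
    intro k t ht
    have e1 := hq ((t : ℂ) - a) (z k - a) (hI t ht) (hzρ _ (hz k))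
    have e2 := mul_norm_sub_le hρ.le hla (h2.le.trans (hzρ _ (hz k)))
    rw [sub_sub_sub_cancel_right, ← hleval] at e1 e2
    calc ‖lam - z k‖ * ‖(l k).eval (t : ℂ)‖
        ≤ ‖lam - z k‖ * (q * (ρ * ‖(t : ℂ) - z k‖)) := by gcongr
      _ = q * ((ρ * ‖lam - z k‖) * ‖(t : ℂ) - z k‖) := by ring
      _ ≤ q * (‖(l k).eval lam‖ * ‖(t : ℂ) - z k‖) := by gcongr
  rw [tendsto_iff_norm_sub_tendsto_zero]
  have hlim : Tendsto (fun n : ℕ => q ^ (n + 1) / d * (σ.real univ + M)) atTop (𝓝 0) := by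
    have := (((tendsto_pow_atTop_nhds_zero_of_lt_one hq0 hq1).comp
      (tendsto_add_atTop_nat 1)).div_const d).mul_const (σ.real univ + M)
    simpa using this
  refine squeeze_zero (fun n => norm_nonneg _) (fun n => ?_) hlim
  rw [norm_sub_rev]
  refine (norm_markovFunction_sub_quadTransform_le hσ hz0 (hG (n + 1)) hlam him hd hq0 hdist l hl hl0
    hlq).trans ?_
  have := hM n _ _ (hG (n + 1))
  gcongr

theorem tendsto_quadTransform (hσ : σ (Set.Icc α β)ᶜ = 0) (hαβ : α ≤ β) {z : ℕ → ℂ}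
    {δ : ℝ} (hδ : 0 < δ) (hz : ∀ k, δ < (z k).im) {N : ℕ → Finset ℝ} {v : ℕ → ℝ → ℝ}
    (hG : ∀ n, IsGaussRule α β σ (nodePoly z n) n (N n) (v n)) {lam : ℂ}
    (hlam : lam ∈ (complexInterval α β)ᶜ) :
    Tendsto (fun n => quadTransform (nodePoly z (n + 1)) (N (n + 1)) (v (n + 1)) lam) atTop
      (𝓝 (markovFunction σ lam)) := by
  rcases le_total 0 lam.im with him | him
  · exact tendsto_quadTransform_of_im_nonneg hσ hαβ hδ hz hG hlam him
  · have := (Complex.continuous_conj.tendsto _).comp (tendsto_quadTransform_of_im_nonneg hσ hαβ hδ hz hG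
      (conj_mem_compl_complexInterval hlam) (by simpa using him))
    simpa [Function.comp_def, quadTransform_conj, markovFunction_conj] using this

theorem norm_inv_sub_inv_le {t lam mu : ℂ} {d : ℝ} (hd : 0 < d) (h1 : d ≤ ‖t - lam‖)
    (h2 : dist mu lam < d / 2) : ‖(t - mu)⁻¹ - (t - lam)⁻¹‖ ≤ 2 / d ^ 2 * dist mu lam := by
  have h3 : d / 2 ≤ ‖t - mu‖ := by
    have := norm_add_le (t - mu) (mu - lam)
    rw [sub_add_sub_cancel] at this
    rw [dist_eq_norm] at h2
    linarith
  have e1 : t - mu ≠ 0 := norm_pos_iff.mp ((half_pos hd).trans_le h3)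
  have e2 : t - lam ≠ 0 := norm_pos_iff.mp (hd.trans_le h1)
  rw [inv_sub_inv e1 e2, sub_sub_sub_cancel_left, norm_div, norm_mul, ← dist_eq_norm mu lam,
    div_mul_eq_mul_div, div_le_div_iff₀ (mul_pos ((half_pos hd).trans_le h3) (hd.trans_le h1))
    (by positivity)]
  have : d / 2 * d ≤ ‖t - mu‖ * ‖t - lam‖ := by gcongr
  nlinarith [dist_nonneg (x := mu) (y := lam)]

/-- All functions are Cauchy transforms of measures on [α, β] of bounded mass, hence share a
Lipschitz bound near lam; three errors of ε/3 finish. -/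
theorem tendstoLocallyUniformlyOn_quadTransform (hσ : σ (Set.Icc α β)ᶜ = 0) (hαβ : α ≤ β) {z : ℕ → ℂ}
    {δ : ℝ} (hδ : 0 < δ) (hz : ∀ k, δ < (z k).im) {N : ℕ → Finset ℝ} {v : ℕ → ℝ → ℝ}
    (hG : ∀ n, IsGaussRule α β σ (nodePoly z n) n (N n) (v n)) :
    TendstoLocallyUniformlyOn
      (fun n lam => quadTransform (nodePoly z (n + 1)) (N (n + 1)) (v (n + 1)) lam)
      (markovFunction σ) atTop (complexInterval α β)ᶜ := by
  have hz0 : ∀ k, (z k).im ≠ 0 := fun k => (hδ.trans (hz k)).ne'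
  obtain ⟨M, hM0, hM⟩ := exists_gauss_mass_bound α β σ hz0
  rw [Metric.tendstoLocallyUniformlyOn_iff]
  intro ε hε lam hlam
  obtain ⟨d, hd, hdist⟩ := exists_dist_le hlam
  set K := 2 / d ^ 2 * (σ.real univ + M + 1) with hK
  have hK0 : 0 < K := by positivity
  have hr : 0 < min (d / 2) (ε / (3 * K)) := lt_min (by positivity) (by positivity)
  refine ⟨Metric.ball lam (min (d / 2) (ε / (3 * K))) ∩ (complexInterval α β)ᶜ,
    inter_mem (nhdsWithin_le_nhds (Metric.ball_mem_nhds _ hr)) self_mem_nhdsWithin, ?_⟩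
  filter_upwards [Metric.tendsto_nhds.mp (tendsto_quadTransform hσ hαβ hδ hz hG hlam) (ε / 3)
    (by positivity)] with n hn mu hmu
  obtain ⟨hmu1, hmuU⟩ := hmu
  have hm1 : dist mu lam < d / 2 := (Metric.mem_ball.mp hmu1).trans_le (min_le_left _ _)
  have hm2 : dist mu lam < ε / (3 * K) := (Metric.mem_ball.mp hmu1).trans_le (min_le_right _ _)
  have hKm : K * dist mu lam < ε / 3 := by
    rw [lt_div_iff₀ (by positivity)] at hm2
    linarith
  have hm0 : 0 ≤ 2 / d ^ 2 * dist mu lam := by positivity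
  have hf : dist (markovFunction σ mu) (markovFunction σ lam) < ε / 3 := by
    refine lt_of_le_of_lt ?_ hKm
    rw [dist_eq_norm, markovFunction, markovFunction, ← integral_sub
      (integrable_of_continuousOn_Icc hσ (continuousOn_inv_ofReal_sub hmuU))
      (integrable_of_continuousOn_Icc hσ (continuousOn_inv_ofReal_sub hlam))]
    calc _ ≤ 2 / d ^ 2 * dist mu lam * σ.real univ := by
          refine norm_integral_le_of_norm_le_const ?_
          filter_upwards [ae_mem_Icc hσ] with t ht
          exact norm_inv_sub_inv_le hd (hdist t ht) hm1
      _ ≤ 2 / d ^ 2 * dist mu lam * (σ.real univ + M + 1) := by gcongr; linarith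
      _ = K * dist mu lam := by rw [hK]; ring
  have hg : dist (quadTransform (nodePoly z (n + 1)) (N (n + 1)) (v (n + 1)) lam)
      (quadTransform (nodePoly z (n + 1)) (N (n + 1)) (v (n + 1)) mu) < ε / 3 := by
    refine lt_of_le_of_lt ?_ hKm
    rw [dist_comm, dist_eq_norm, quadTransform, quadTransform, ← Finset.sum_sub_distrib]
    have hMn := hM n _ _ (hG (n + 1))
    calc _ ≤ ∑ x ∈ N (n + 1), 2 / d ^ 2 * dist mu lam *
          (v (n + 1) x * (nodePoly z (n + 1)).eval x) := by
          refine (norm_sum_le _ _).trans (Finset.sum_le_sum fun x hx => ?_)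
          have hpos := mul_pos ((hG (n + 1)).pos x hx) (eval_nodePoly_pos hz0 (n + 1) x)
          rw [← mul_sub, norm_mul, Complex.norm_real, Real.norm_of_nonneg hpos.le, mul_comm]
          exact mul_le_mul_of_nonneg_right
            (norm_inv_sub_inv_le hd (hdist x ((hG (n + 1)).mem x hx)) hm1) hpos.le
      _ ≤ 2 / d ^ 2 * dist mu lam * M := by
          rw [← Finset.mul_sum]
          exact mul_le_mul_of_nonneg_left hMn hm0
      _ ≤ 2 / d ^ 2 * dist mu lam * (σ.real univ + M + 1) := by
          have : 0 ≤ σ.real univ := measureReal_nonneg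
          gcongr; linarith
      _ = K * dist mu lam := by rw [hK]; ring
  rw [dist_comm] at hn
  have t1 := dist_triangle4 (markovFunction σ mu) (markovFunction σ lam)
    (quadTransform (nodePoly z (n + 1)) (N (n + 1)) (v (n + 1)) lam)
    (quadTransform (nodePoly z (n + 1)) (N (n + 1)) (v (n + 1)) mu)
  linarith

end Convergence

end

theorem mainTheorem1 (α β : ℝ) (σ : Measure ℝ) [IsFiniteMeasure σ]
    (hσ : σ (Set.Icc α β)ᶜ = 0) (hsupp : σ.support.Infinite)
    (z : ℕ → ℂ) (δ : ℝ) (hδ : 0 < δ) (hz : ∀ k, δ < (z k).im)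
    (b : ℕ → ℝ) (hb : ∀ j, 0 < b j) :
    (∀ (n : ℕ) (f : RatFunc ℂ),
      IsMultipointPade (markovFunction σ) (padeNodes z) (n + 1) (n + 1) f ↔
        f = convergent (markovFunction σ) z b n) ∧
    (∀ (n : ℕ), ∀ lam ∈ (complexInterval α β)ᶜ,
      (convergent (markovFunction σ) z b n).denom.eval lam ≠ 0) ∧
    TendstoLocallyUniformlyOn
      (fun (n : ℕ) (lam : ℂ) =>
        (convergent (markovFunction σ) z b n).eval (RingHom.id ℂ) lam)
      (markovFunction σ) atTop (complexInterval α β)ᶜ := by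
  have hz0 : ∀ k, (z k).im ≠ 0 := fun k => (hδ.trans (hz k)).ne'
  -- An empty interval would force σ = 0, whose support is empty.
  have hαβ : α ≤ β := by
    by_contra h
    rw [Set.Icc_eq_empty h, Set.compl_empty, Measure.measure_univ_eq_zero] at hσ
    simp [hσ] at hsupp
  choose N v hG using fun n => exists_isGaussRule hσ hsupp (eval_nodePoly_pos hz0 n) n
  have hsys := isPadeSystem_markovFunction hσ hsupp hz0 hG
  have hconv := hsys.convergent_eq hz0 (fun j => (hb j).ne')
  have hφ0 := tendsto_markovFunction_cobounded hσ
  refine ⟨fun n f => ⟨fun hf => ?_, ?_⟩, fun n lam hlam => ?_, ?_⟩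
  · rw [hconv]
    exact hsys.eq_of_isMultipointPade hz0 hφ0 n hf
  · rintro rfl
    rw [hconv]
    exact hsys.isMultipointPade hz0
      (fun n => differentiableOn_secondKind hσ (eval_nodePoly_pos hz0 n) _)
      (differentiableOn_markovFunction hσ) hφ0 n
  · rw [hconv]
    exact denom_eval_ne_zero (hsys.denom_ne_zero _ _ hlam)
  · refine (tendstoLocallyUniformlyOn_quadTransform hσ hαβ hδ hz hG).congr fun n lam hlam => ?_
    rw [hconv]
    have hQ := hsys.denom_ne_zero (n + 1) lam hlam
    have hP := aeval_gaussNum (nodePoly z (n + 1)) (N (n + 1)) (v (n + 1))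
      fun x hx => ofReal_sub_ne_zero hlam ((hG (n + 1)).mem x hx)
    change _ = (toRatFunc _ / toRatFunc _).eval (RingHom.id ℂ) lam
    rw [eval_toRatFunc_div hQ, hP, mul_div_cancel_left₀ _ hQ]
    rfl
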